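/- Let $(Y,d)$ be a nonempty geodesic metric space: any two points $x,y\in Y$ are joined by a Lipschitz curve $[0,1]\to Y$ of length $d(x,y)$. Let $N\ge 1$ be an integer and let $0\le\alpha<1$. Let $\mathcal A_N(Y)$ be the set of probability measures on $Y$ of the form $\sum_{i=1}^m a_i\delta_{x_i}$ with $m\le N$, $a_i>0$ and $x_i\in Y$ distinct. For $\mathbf a=\sum_i a_i\delta_{x_i}$ and $\mathbf b=\sum_j b_j\delta_{y_j}$ in $\mathcal A_N(Y)$ put $$J_\alpha(\mathbf a,\mathbf b)=\min_\gamma \sum_{\gamma_{ij}>0}\gamma_{ij}^{\alpha}\,d(x_i,y_j),$$ the minimum being over all matrices $\gamma_{ij}\ge 0$ with $\sum_j\gamma_{ij}=a_i$ and $\sum_i\gamma_{ij}=b_j$. A quasimetric on a nonempty set $X$ is a function $J:X\times X\to[0,\infty)$ such that $J(x,y)=0$ iff $x=y$, $J(x,y)=J(y,x)$, and $J(x,y)\le\sigma\,(J(x,z)+J(z,y))$ for all $x,y,z$, for some constant $\sigma\ge 1$. For $k\in\mathbb N$ let $D_J^{(k)}(x,y)\in[0,\infty]$ be the infimum of the lengths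 $$L_J(f)=\int_0^1|\dot f(t)|_J\,dt,\qquad |\dot f(t)|_J=\lim_{s\to t}\frac{J(f(s),f(t))}{|s-t|},$$ over all continuous curves $f:[0,1]\to(X,J)$ with $f(0)=x$ and $f(1)=y$ for which there is a partition $0=t_0<t_1<\dots<t_k=1$ such that, for each $i<k$, $J$ is a metric on $f([t_i,t_{i+1}])$ and $f$ is Lipschitz on $[t_i,t_{i+1}]$ (the infimum is $\infty$ if there is no such curve). Put $D_J(x,y)=\lim_{k\to\infty}D_J^{(k)}(x,y)$. The quasimetric $J$ is called perfect if for all $x,y\in X$ the value $D_J(x,y)$ is finite and $D_J^{(k)}(x,y)=D_J(x,y)$ for all sufficiently large $k$. Then $J_\alpha$ is a perfect quasimetric on $X=\mathcal A_N(Y)$. More precisely, for all $\mathbf a,\mathbf b\in\mathcal A_N(Y)$ and all $k\ge 4N-3$, $$D_{J_\alpha}^{(k)}(\mathbf a,\mathbf b)=D_{J_\alpha}^{(4N-3)}(\mathbf a,\mathbf b)=D_{J_\alpha}(\mathbf a,\mathbf b)<\infty,$$ and $D_{J_\alpha}$ is a metric on $\mathcal A_N(Y)$. -/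

import Mathlib

open Set Filter Topology MeasureTheory

namespace RamifiedTransport

noncomputable section

/-! ### Quasimetrics and the intrinsic distance they induce -/

section Quasimetric

variable {X : Type*}

/-- The function `J` restricted to the subset `S` is a metric. -/
structure IsMetricOn (J : X → X → ℝ) (S : Set X) : Prop where
  nonneg : ∀ x ∈ S, ∀ y ∈ S, 0 ≤ J x y
  eq_zero_iff : ∀ x ∈ S, ∀ y ∈ S, J x y = 0 ↔ x = y
  symm : ∀ x ∈ S, ∀ y ∈ S, J x y = J y x
  triangle : ∀ x ∈ S, ∀ y ∈ S, ∀ z ∈ S, J x y ≤ J x z + J z y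

/-- The function `J` is a quasimetric on the nonempty set `X`. -/
structure IsQuasimetric (J : X → X → ℝ) : Prop where
  nonempty : Nonempty X
  nonneg : ∀ x y, 0 ≤ J x y
  eq_zero_iff : ∀ x y, J x y = 0 ↔ x = y
  symm : ∀ x y, J x y = J y x
  relaxed_triangle : ∃ σ : ℝ, 1 ≤ σ ∧ ∀ x y z, J x y ≤ σ * (J x z + J z y)

/-- The map `f : [a,b] → (X,J)` is continuous. (Only the values of `f` on `[a,b]` matter.) -/
def IsContinuousCurve (J : X → X → ℝ) (f : ℝ → X) (a b : ℝ) : Prop :=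
  ∀ t ∈ Icc a b, Tendsto (fun s => J (f s) (f t)) (𝓝[Icc a b] t) (𝓝 0)

/-- The curve `f : [a,b] → (X,J)` is a `k`-piecewise metric Lipschitz curve: it is continuous and
there is a partition `a = p 0 < p 1 < ⋯ < p k = b` such that, on each `[p i, p (i+1)]`, the
function `J` is a metric on the image of `f` and `f` is Lipschitz. -/
def IsPiecewiseMetricLipschitz (J : X → X → ℝ) (k : ℕ) (f : ℝ → X) (a b : ℝ) : Prop :=
  IsContinuousCurve J f a b ∧
    ∃ p : ℕ → ℝ, p 0 = a ∧ p k = b ∧ ∀ i < k, p i < p (i + 1) ∧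
      IsMetricOn J (f '' Icc (p i) (p (i + 1))) ∧
      ∃ C : ℝ, 0 ≤ C ∧ ∀ s ∈ Icc (p i) (p (i + 1)), ∀ t ∈ Icc (p i) (p (i + 1)),
        J (f s) (f t) ≤ C * |s - t|

/-- The metric derivative `lim_{s → t} J (f s) (f t) / |s - t|` of `f : [a,b] → (X,J)` at `t`.
The upper limit is the limit wherever the limit exists, which for a piecewise metric
Lipschitz curve is the case at almost every `t`. -/
def metricDeriv (J : X → X → ℝ) (f : ℝ → X) (a b t : ℝ) : ENNReal :=
  limsup (fun s => ENNReal.ofReal (J (f s) (f t) / |s - t|)) (𝓝[Icc a b \ {t}] t)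

/-- The length `L_J(f) = ∫_a^b |f'(t)|_J dt`. -/
def curveLength (J : X → X → ℝ) (f : ℝ → X) (a b : ℝ) : ENNReal :=
  ∫⁻ t in Icc a b, metricDeriv J f a b t

/-- The family `Path_k(x,y)` of `k`-piecewise metric Lipschitz curves `[0,1] → (X,J)` from `x`
to `y`. -/
def PathSet (J : X → X → ℝ) (k : ℕ) (x y : X) : Set (ℝ → X) :=
  {f | IsPiecewiseMetricLipschitz J k f 0 1 ∧ f 0 = x ∧ f 1 = y}

/-- `D_J^{(k)}(x,y)`: the infimum of the lengths of the curves in `Path_k(x,y)`, which is `∞` if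
there is no such curve. -/
def distPieces (J : X → X → ℝ) (k : ℕ) (x y : X) : ENNReal :=
  ⨅ f ∈ PathSet J k x y, curveLength J f 0 1

/-- `D_J(x,y) = lim_{k → ∞} D_J^{(k)}(x,y)`. -/
def intrinsicDist (J : X → X → ℝ) (x y : X) : ENNReal :=
  limUnder atTop (fun k : ℕ => distPieces J k x y)

/-- A quasimetric `J` is perfect if for all `x, y` the value `D_J^{(k)}(x,y)` is equal to the real
constant `D_J(x,y)` for all large `k`. -/
def IsPerfectQuasimetric (J : X → X → ℝ) : Prop :=
  IsQuasimetric J ∧ ∀ x y, intrinsicDist J x y ≠ ⊤ ∧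
    ∀ᶠ k in atTop, distPieces J k x y = intrinsicDist J x y

end Quasimetric

/-! ### Atomic probability measures and the functions `J_α` -/

section Transport

/-- The space `A_N(Y)` of atomic probability measures `∑ a_i δ_{y_i}` on `Y` with at most `N`
atoms. Such a measure is given by its finitely supported weight function `y ↦ a({y})`. -/
abbrev AtomicProb (N : ℕ) (Y : Type*) : Type _ :=
  {a : Y →₀ ℝ // (∀ y, 0 ≤ a y) ∧ (a.sum fun _ m => m) = 1 ∧ a.support.card ≤ N}

/-- The transport plans from `a` to `b`: atomic measures on `Y × Y` with marginals `a` and `b`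
(`Finsupp.mapDomain` is the push-forward). -/
def Plan {Y : Type*} (a b : Y →₀ ℝ) : Set (Y × Y →₀ ℝ) :=
  {γ | (∀ p, 0 ≤ γ p) ∧ γ.mapDomain Prod.fst = a ∧ γ.mapDomain Prod.snd = b}

variable {Y : Type*} [MetricSpace Y]

/-- `H_α(γ) = ∑ γ_{ij}^α d(x_i,y_j)`, the sum being over the atoms of `γ`
(so `0 ^ α` counts as `0`, also for `α = 0`). -/
def planCost (α : ℝ) (γ : Y × Y →₀ ℝ) : ℝ :=
  γ.sum fun p m => m ^ α * dist p.1 p.2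

/-- `J_α(a,b)`, the minimal value of `H_α` on the transport plans from `a` to `b`. -/
def transportQuasimetric (α : ℝ) {N : ℕ} (a b : AtomicProb N Y) : ℝ :=
  sInf (planCost α '' Plan a.1 b.1)

end Transport

/-- `Y` is a geodesic metric space: any two points `x, y` are joined by a Lipschitz curve
`[0,1] → Y` whose length (supremum of the variations over all partitions) is `d(x,y)`. -/
def IsGeodesicSpace (Y : Type*) [MetricSpace Y] : Prop :=
  ∀ x y : Y, ∃ Γ : ℝ → Y, (∃ K, LipschitzOnWith K Γ (Icc 0 1)) ∧ Γ 0 = x ∧ Γ 1 = y ∧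
    eVariationOn Γ (Icc 0 1) = edist x y

end

end RamifiedTransport

/-! The intrinsic distance is identified with a combinatorial one. A move carries a mass m from x to
y while a measure with fewer than N atoms rests; it costs m^α d(x,y), and `chainDist` is the infimum
of the total costs of finite chains of moves. It is a finite metric, so everything follows from the
equality of D^(k) with `chainDist` for k ≥ 4N-3 (`distPieces_eq_chainDist`).

Upper bound. The two ends of a move have J_α-distance exactly m^α d(x,y), because the mass m has to
cross every sphere around x of radius less than d(x,y) (`wt_mul_dist_le_planCost`). Hence a move
along a geodesic is a metric Lipschitz piece, and a chain of k moves is a curve with k pieces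
(`Chain.exists_curve`). It remains to shorten chains to 4N-3 moves at no extra cost
(`Chain.exists_short`). A chain is a flow on a time-expanded graph. If there are at least as many
edges as vertices, a dimension count gives a nonzero perturbation (`Network.exists_isFlow`), and
concavity of the cost allows pushing along it in one of the two directions until an edge is empty.
So one may assume fewer edges than vertices, and then at most N-1 moves merge and at most N-1 split.
When the number of moves is least, each non-merging move can be charged to a merging, a splitting or
a final atom, which leaves at most 2(N-1) + (N-1) + N moves (`Network.card_nontrivial_le`).

Lower bound. Let V(t) be the chain distance from the start of a Lipschitz piece f to f(t). If f(t)
has fewer than N atoms, the spare atom lets plans be realized by chains: `chainDist` is at most 3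
J_α, and at most (1+η) J_α for nearby measures with no more atoms. If f(t) has N atoms, then α < 1
forces the masses to be constant near t, and matching the atoms gives `chainDist` ≤ J_α. Thus V is
Lipschitz. For all but countably many t there are times tending to t at which the sharp comparison
holds, so |V'| is at most the metric derivative where V' exists; integration gives
`chainDist_le_curveLength`. -/

namespace RamifiedTransport

noncomputable section

/-! ### The concave weight -/

/-- The weight `m ^ α`, with value `0` at `0` also for `α = 0`. -/
def wt (α m : ℝ) : ℝ := if m = 0 then 0 else m ^ α

section Weight

variable {α : ℝ}

@[simp] lemma wt_zero : wt α 0 = 0 := by simp [wt]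

lemma wt_of_ne_zero {m : ℝ} (hm : m ≠ 0) : wt α m = m ^ α := by simp [wt, hm]

lemma wt_nonneg {m : ℝ} (hm : 0 ≤ m) : 0 ≤ wt α m := by
  unfold wt; split_ifs
  · exact le_rfl
  · exact Real.rpow_nonneg hm _

lemma wt_pos {m : ℝ} (hm : 0 < m) : 0 < wt α m := by
  rw [wt_of_ne_zero hm.ne']; exact Real.rpow_pos_of_pos hm _

lemma wt_mono (hα : 0 ≤ α) {m m' : ℝ} (hm : 0 ≤ m) (h : m ≤ m') : wt α m ≤ wt α m' := by
  rcases hm.eq_or_lt with rfl | hm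
  · simpa using wt_nonneg h
  · rw [wt_of_ne_zero hm.ne', wt_of_ne_zero (hm.trans_le h).ne']
    exact Real.rpow_le_rpow hm.le h hα

lemma wt_add_le (hα : 0 ≤ α) (hα1 : α ≤ 1) {m m' : ℝ} (hm : 0 ≤ m) (hm' : 0 ≤ m') :
    wt α (m + m') ≤ wt α m + wt α m' := by
  rcases hm.eq_or_lt with rfl | hm
  · simp
  rcases hm'.eq_or_lt with rfl | hm'
  · simp
  rw [wt_of_ne_zero hm.ne', wt_of_ne_zero hm'.ne', wt_of_ne_zero (add_pos hm hm').ne']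
  have := NNReal.rpow_add_le_add_rpow ⟨m, hm.le⟩ ⟨m', hm'.le⟩ hα hα1
  exact_mod_cast this

lemma wt_sum_le (hα : 0 ≤ α) (hα1 : α ≤ 1) {ι : Type*} (s : Finset ι) (f : ι → ℝ)
    (hf : ∀ i ∈ s, 0 ≤ f i) : wt α (∑ i ∈ s, f i) ≤ ∑ i ∈ s, wt α (f i) := by
  classical
  induction s using Finset.induction_on with
  | empty => simp
  | insert i s his ih =>
    rw [Finset.sum_insert his, Finset.sum_insert his]
    have h1 := ih fun j hj => hf j (Finset.mem_insert_of_mem hj)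
    have h2 := wt_add_le hα hα1 (hf i (Finset.mem_insert_self i s))
      (Finset.sum_nonneg fun j hj => hf j (Finset.mem_insert_of_mem hj))
    linarith

/-- For `α = 0` the weight jumps upwards from 0 to 1 at the end point of the half-line, which
concavity permits. -/
lemma wt_concave (hα : 0 ≤ α) (hα1 : α ≤ 1) : ConcaveOn ℝ (Ici 0) (wt α) := by
  rcases hα.eq_or_lt with rfl | hα
  · refine ⟨convex_Ici 0, fun x hx y hy a b ha hb hab => ?_⟩
    simp only [smul_eq_mul, mem_Ici] at *
    have key : ∀ t : ℝ, 0 ≤ t → wt 0 t ≤ 1 := fun t _ => by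
      unfold wt; split_ifs <;> simp
    have kx := key x hx
    have ky := key y hy
    by_cases h : a * x + b * y = 0
    · have h1 : a * x = 0 := by nlinarith [mul_nonneg ha hx, mul_nonneg hb hy]
      have h2 : b * y = 0 := by nlinarith [mul_nonneg ha hx, mul_nonneg hb hy]
      rw [h, wt_zero]
      have e1 : a * wt 0 x = 0 := by
        rcases mul_eq_zero.1 h1 with h | h <;> simp [h]
      have e2 : b * wt 0 y = 0 := by
        rcases mul_eq_zero.1 h2 with h | h <;> simp [h]
      linarith
    · rw [wt_of_ne_zero h, Real.rpow_zero]
      nlinarith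
  · have : wt α = fun x : ℝ => x ^ α := by
      funext x
      by_cases hx : x = 0
      · simp [hx, Real.zero_rpow hα.ne']
      · exact wt_of_ne_zero hx
    rw [this]
    exact Real.concaveOn_rpow hα.le hα1

lemma le_wt (hα1 : α ≤ 1) {m : ℝ} (hm : 0 ≤ m) (hm1 : m ≤ 1) : m ≤ wt α m := by
  rcases hm.eq_or_lt with rfl | hm
  · simp
  · rw [wt_of_ne_zero hm.ne']
    simpa using Real.rpow_le_rpow_of_exponent_ge hm hm1 hα1

end Weight

/-! ### Integration against finitely supported functions -/

section Pairing

variable {Y : Type*}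

/-- The integral of `φ` with respect to `a`. -/
def pairing (φ : Y → ℝ) (a : Y →₀ ℝ) : ℝ := a.sum fun z m => m * φ z

lemma pairing_add (φ : Y → ℝ) (a b : Y →₀ ℝ) :
    pairing φ (a + b) = pairing φ a + pairing φ b :=
  Finsupp.sum_add_index' (by simp) (by intros; ring)

lemma pairing_single (φ : Y → ℝ) (z : Y) (m : ℝ) :
    pairing φ (Finsupp.single z m) = m * φ z :=
  Finsupp.sum_single_index (by simp)

lemma pairing_eq_sum (φ : Y → ℝ) {a : Y →₀ ℝ} {S : Finset Y} (h : a.support ⊆ S) :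
    pairing φ a = ∑ z ∈ S, a z * φ z :=
  Finsupp.sum_of_support_subset _ h _ (by simp)

lemma pairing_mapDomain {Z : Type*} (φ : Y → ℝ) (g : Z → Y) (a : Z →₀ ℝ) :
    pairing φ (a.mapDomain g) = pairing (φ ∘ g) a :=
  Finsupp.sum_mapDomain_index (by simp) (by intros; ring)

lemma pairing_one (a : Y →₀ ℝ) : pairing (fun _ => 1) a = a.sum fun _ m => m := by
  simp [pairing]

lemma apply_le_total {a : Y →₀ ℝ} (ha : ∀ y, 0 ≤ a y) (h1 : (a.sum fun _ m => m) = 1) (z : Y) :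
    a z ≤ 1 := by
  classical
  rw [← h1]
  by_cases hz : z ∈ a.support
  · exact Finset.single_le_sum (f := fun y => a y) (fun y _ => ha y) hz
  · rw [Finsupp.notMem_support_iff.1 hz]
    exact Finset.sum_nonneg fun y _ => ha y

end Pairing

/-! ### Transport plans as matrices -/

section Plans

variable {Y : Type*}

open Classical in
lemma mapDomain_fst_apply {γ : Y × Y →₀ ℝ} {S T : Finset Y} (h : γ.support ⊆ S ×ˢ T) {x : Y}
    (hx : x ∈ S) : γ.mapDomain Prod.fst x = ∑ y ∈ T, γ (x, y) := by
  have h1 : γ.mapDomain Prod.fst = ∑ p ∈ S ×ˢ T, Finsupp.single p.1 (γ p) :=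
    Finsupp.sum_of_support_subset _ h _ (by simp)
  rw [h1, Finsupp.finsetSum_apply, Finset.sum_product,
    Finset.sum_eq_single_of_mem x hx]
  · simp
  · intro z _ hz
    exact Finset.sum_eq_zero fun y _ => by simp [hz]

open Classical in
lemma mapDomain_snd_apply {γ : Y × Y →₀ ℝ} {S T : Finset Y} (h : γ.support ⊆ S ×ˢ T) {y : Y}
    (hy : y ∈ T) : γ.mapDomain Prod.snd y = ∑ x ∈ S, γ (x, y) := by
  have h1 : γ.mapDomain Prod.snd = ∑ p ∈ S ×ˢ T, Finsupp.single p.2 (γ p) :=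
    Finsupp.sum_of_support_subset _ h _ (by simp)
  rw [h1, Finsupp.finsetSum_apply, Finset.sum_product_right,
    Finset.sum_eq_single_of_mem y hy]
  · simp
  · intro z _ hz
    exact Finset.sum_eq_zero fun y _ => by simp [hz]

lemma apply_le_mapDomain {Z : Type*} {γ : Z →₀ ℝ} (hγ : ∀ p, 0 ≤ γ p) (g : Z → Y) (p : Z) :
    γ p ≤ γ.mapDomain g (g p) := by
  classical
  by_cases hp : p ∈ γ.support
  · rw [Finsupp.mapDomain, Finsupp.sum, Finsupp.finsetSum_apply]
    refine le_trans (by simp) (Finset.single_le_sum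
      (f := fun q => (Finsupp.single (g q) (γ q)) (g p)) (fun q _ => ?_) hp)
    simp only [Finsupp.single_apply]; split_ifs; exacts [hγ q, le_rfl]
  · rw [Finsupp.notMem_support_iff.1 hp, Finsupp.mapDomain, Finsupp.sum, Finsupp.finsetSum_apply]
    refine Finset.sum_nonneg fun q _ => ?_
    simp only [Finsupp.single_apply]; split_ifs; exacts [hγ q, le_rfl]

lemma Plan.support_subset {a b : Y →₀ ℝ} {γ : Y × Y →₀ ℝ} (hγ : γ ∈ Plan a b) :
    γ.support ⊆ a.support ×ˢ b.support := by
  classical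
  rintro p hp
  have h0 : 0 < γ p := lt_of_le_of_ne (hγ.1 p) (Ne.symm (Finsupp.mem_support_iff.1 hp))
  have h1 := apply_le_mapDomain hγ.1 Prod.fst p
  have h2 := apply_le_mapDomain hγ.1 Prod.snd p
  rw [hγ.2.1] at h1
  rw [hγ.2.2] at h2
  exact Finset.mem_product.2 ⟨Finsupp.mem_support_iff.2 (h0.trans_le h1).ne',
    Finsupp.mem_support_iff.2 (h0.trans_le h2).ne'⟩

lemma Plan.sum_right {a b : Y →₀ ℝ} {γ : Y × Y →₀ ℝ} (hγ : γ ∈ Plan a b) {x : Y}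
    (hx : x ∈ a.support) : ∑ y ∈ b.support, γ (x, y) = a x := by
  rw [← mapDomain_fst_apply (Plan.support_subset hγ) hx, hγ.2.1]

lemma Plan.sum_left {a b : Y →₀ ℝ} {γ : Y × Y →₀ ℝ} (hγ : γ ∈ Plan a b) {y : Y}
    (hy : y ∈ b.support) : ∑ x ∈ a.support, γ (x, y) = b y := by
  rw [← mapDomain_snd_apply (Plan.support_subset hγ) hy, hγ.2.2]

/-- Mass crossing the boundary of a set `A` has to be carried by the plan. -/
lemma wt_cut_le {α : ℝ} (hα : 0 ≤ α) (hα1 : α ≤ 1) {a b : Y →₀ ℝ} {γ : Y × Y →₀ ℝ}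
    (hγ : γ ∈ Plan a b) (A : Set Y) :
    wt α |pairing (A.indicator 1) a - pairing (A.indicator 1) b| ≤
      ∑ p ∈ γ.support, wt α (γ p) * |A.indicator 1 p.1 - A.indicator (1 : Y → ℝ) p.2| := by
  have h1 : pairing (A.indicator 1) a - pairing (A.indicator 1) b =
      ∑ p ∈ γ.support, γ p * (A.indicator 1 p.1 - A.indicator (1 : Y → ℝ) p.2) := by
    rw [← hγ.2.1, ← hγ.2.2, pairing_mapDomain, pairing_mapDomain, pairing, pairing, Finsupp.sum,
      Finsupp.sum, ← Finset.sum_sub_distrib]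
    exact Finset.sum_congr rfl fun p _ => by simp [mul_sub]
  rw [h1]
  refine (wt_mono hα (abs_nonneg _) (Finset.abs_sum_le_sum_abs _ _)).trans ?_
  refine (wt_sum_le hα hα1 _ _ fun _ _ => abs_nonneg _).trans (Finset.sum_le_sum fun p _ => ?_)
  rw [abs_mul, abs_of_nonneg (hγ.1 p)]
  by_cases h1 : p.1 ∈ A <;> by_cases h2 : p.2 ∈ A <;> simp [h1, h2]

variable [MetricSpace Y]

lemma planCost_eq_sum {α : ℝ} {γ : Y × Y →₀ ℝ} {U : Finset (Y × Y)} (h : γ.support ⊆ U) :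
    planCost α γ = ∑ p ∈ U, wt α (γ p) * dist p.1 p.2 := by
  rw [planCost, Finsupp.sum, ← Finset.sum_subset h]
  · refine Finset.sum_congr rfl fun p hp => ?_
    rw [wt_of_ne_zero (Finsupp.mem_support_iff.1 hp)]
  · intro p _ hp
    rw [Finsupp.notMem_support_iff.1 hp]; simp

lemma planCost_nonneg {α : ℝ} {γ : Y × Y →₀ ℝ} (h : ∀ p, 0 ≤ γ p) : 0 ≤ planCost α γ := by
  rw [planCost_eq_sum (Finset.Subset.refl _)]
  exact Finset.sum_nonneg fun p _ => mul_nonneg (wt_nonneg (h p)) dist_nonneg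

lemma Plan.cost_eq {α : ℝ} {a b : Y →₀ ℝ} {γ : Y × Y →₀ ℝ} (hγ : γ ∈ Plan a b) :
    planCost α γ = ∑ x ∈ a.support, ∑ y ∈ b.support, wt α (γ (x, y)) * dist x y := by
  rw [planCost_eq_sum (Plan.support_subset hγ), Finset.sum_product]

/-- A matrix with the right marginals gives a plan. -/
lemma exists_plan_of_matrix {α : ℝ} {a b : Y →₀ ℝ} {S T : Finset Y} (g : Y → Y → ℝ)
    (hg : ∀ x ∈ S, ∀ y ∈ T, 0 ≤ g x y) (hS : a.support ⊆ S) (hT : b.support ⊆ T)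
    (ha : ∀ x ∈ S, ∑ y ∈ T, g x y = a x) (hb : ∀ y ∈ T, ∑ x ∈ S, g x y = b y) :
    ∃ γ ∈ Plan a b, planCost α γ = ∑ x ∈ S, ∑ y ∈ T, wt α (g x y) * dist x y := by
  classical
  let γ : Y × Y →₀ ℝ := Finsupp.onFinset (S ×ˢ T)
    (fun p => if p ∈ S ×ˢ T then g p.1 p.2 else 0) (by intro p; simp; tauto)
  have hγ : ∀ p, γ p = if p ∈ S ×ˢ T then g p.1 p.2 else 0 := fun p => rfl
  have hsupp : γ.support ⊆ S ×ˢ T := Finsupp.support_onFinset_subset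
  refine ⟨γ, ⟨fun p => ?_, ?_, ?_⟩, ?_⟩
  · rw [hγ]; split_ifs with h
    · exact hg _ (Finset.mem_product.1 h).1 _ (Finset.mem_product.1 h).2
    · exact le_rfl
  · ext x
    by_cases hx : x ∈ S
    · rw [mapDomain_fst_apply hsupp hx, ← ha x hx]
      exact Finset.sum_congr rfl fun y hy => by simp [hγ, hx, hy]
    · rw [Finsupp.notMem_support_iff.1 fun h => hx (hS h)]
      refine Finsupp.notMem_support_iff.1 fun h => hx ?_
      obtain ⟨p, hp, rfl⟩ := Finset.mem_image.1 (Finsupp.mapDomain_support h)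
      exact (Finset.mem_product.1 (hsupp hp)).1
  · ext y
    by_cases hy : y ∈ T
    · rw [mapDomain_snd_apply hsupp hy, ← hb y hy]
      exact Finset.sum_congr rfl fun x hx => by simp [hγ, hx, hy]
    · rw [Finsupp.notMem_support_iff.1 fun h => hy (hT h)]
      refine Finsupp.notMem_support_iff.1 fun h => hy ?_
      obtain ⟨p, hp, rfl⟩ := Finset.mem_image.1 (Finsupp.mapDomain_support h)
      exact (Finset.mem_product.1 (hsupp hp)).2
  · rw [planCost_eq_sum hsupp, Finset.sum_product]
    exact Finset.sum_congr rfl fun x hx => Finset.sum_congr rfl fun y hy => by simp [hγ, hx, hy]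

/-- Every atom of the plan that crosses the boundary of `A` travels at least `δ`. With singletons
and balls for `A`, this is how a small cost controls masses. -/
lemma wt_cut_mul_le_planCost {α : ℝ} (hα : 0 ≤ α) (hα1 : α ≤ 1) {a b : Y →₀ ℝ} {γ : Y × Y →₀ ℝ}
    (hγ : γ ∈ Plan a b) (A : Set Y) {δ : ℝ} (hδ : 0 ≤ δ)
    (h : ∀ p ∈ a.support, ∀ q ∈ b.support, ¬ (p ∈ A ↔ q ∈ A) → δ ≤ dist p q) :
    δ * wt α |pairing (A.indicator 1) a - pairing (A.indicator 1) b| ≤ planCost α γ := by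
  refine (mul_le_mul_of_nonneg_left (wt_cut_le hα hα1 hγ A) hδ).trans ?_
  rw [planCost_eq_sum (Finset.Subset.refl _), Finset.mul_sum]
  refine Finset.sum_le_sum fun p hp => ?_
  have hp' := Finset.mem_product.1 (Plan.support_subset hγ hp)
  have hw := wt_nonneg (α := α) (hγ.1 p)
  have := h p.1 hp'.1 p.2 hp'.2
  rw [mul_left_comm]
  refine mul_le_mul_of_nonneg_left ?_ hw
  by_cases h1 : p.1 ∈ A <;> by_cases h2 : p.2 ∈ A <;> simp [h1, h2] at this ⊢ <;> assumption

/-- Moving mass `m` from `u` to `v` costs at least `m ^ α * d(u,v)`. -/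
lemma wt_mul_dist_le_planCost {α : ℝ} (hα : 0 ≤ α) (hα1 : α ≤ 1) {s : Y →₀ ℝ} {m : ℝ}
    (hm : 0 ≤ m) {u v : Y} {γ : Y × Y →₀ ℝ}
    (hγ : γ ∈ Plan (s + Finsupp.single u m) (s + Finsupp.single v m)) :
    wt α m * dist u v ≤ planCost α γ := by
  -- The closed ball of radius `r` around `u` contains `u` but not `v`, so a net mass `m` leaves it.
  -- Integrating over `r` gives the factor d(u,v).
  have key : ∀ r ∈ Ico 0 (dist u v), wt α m ≤ ∑ p ∈ γ.support, wt α (γ p) *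
      (Ico (min (dist u p.1) (dist u p.2)) (max (dist u p.1) (dist u p.2))).indicator 1 r := by
    intro r hr
    have h1 := wt_cut_le hα hα1 hγ {z | dist u z ≤ r}
    rw [pairing_add, pairing_add, pairing_single, pairing_single] at h1
    simp only [mem_ofPred_eq, dist_self, hr.1, indicator_of_mem, not_le.2 hr.2, not_false_eq_true,
      indicator_of_notMem, Pi.one_apply] at h1
    rw [show ∀ t : ℝ, t + m * 1 - (t + m * 0) = m from fun t => by ring, abs_of_nonneg hm] at h1
    refine h1.trans (Finset.sum_le_sum fun p _ => mul_le_mul_of_nonneg_left ?_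
      (wt_nonneg (hγ.1 p)))
    by_cases c1 : dist u p.1 ≤ r <;> by_cases c2 : dist u p.2 ≤ r <;>
      simp [indicator, c1, c2] <;> grind
  have hlin : ENNReal.ofReal (wt α m * dist u v) ≤ ENNReal.ofReal (planCost α γ) := by
    calc ENNReal.ofReal (wt α m * dist u v)
        = ∫⁻ _ in Ico 0 (dist u v), ENNReal.ofReal (wt α m) := by
          rw [setLIntegral_const, Real.volume_Ico, sub_zero, ENNReal.ofReal_mul (wt_nonneg hm)]
      _ ≤ ∫⁻ r in Ico 0 (dist u v), ∑ p ∈ γ.support, ENNReal.ofReal (wt α (γ p)) *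
          (Ico (min (dist u p.1) (dist u p.2)) (max (dist u p.1) (dist u p.2))).indicator 1 r := by
          refine setLIntegral_mono' measurableSet_Ico fun r hr => ?_
          refine (ENNReal.ofReal_le_ofReal (key r hr)).trans ?_
          rw [ENNReal.ofReal_sum_of_nonneg]
          · refine Finset.sum_le_sum fun p _ => ?_
            rw [ENNReal.ofReal_mul (wt_nonneg (hγ.1 p))]
            gcongr
            by_cases h : r ∈ Ico (min (dist u p.1) (dist u p.2)) (max (dist u p.1) (dist u p.2))
            · simp only [indicator_of_mem h]; simp
            · simp only [indicator_of_notMem h]; simp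
          · intro p _
            exact mul_nonneg (wt_nonneg (hγ.1 p)) (indicator_nonneg (fun _ _ => zero_le_one) _)
      _ ≤ ∫⁻ r, ∑ p ∈ γ.support, ENNReal.ofReal (wt α (γ p)) *
          (Ico (min (dist u p.1) (dist u p.2)) (max (dist u p.1) (dist u p.2))).indicator 1 r :=
          setLIntegral_le_lintegral _ _
      -- The atom `p` crosses the sphere for radii in an interval of length |d(u,p.1) - d(u,p.2)|,
      -- which is at most the distance it travels.
      _ = ∑ p ∈ γ.support, ENNReal.ofReal (wt α (γ p)) *
          ENNReal.ofReal |dist u p.1 - dist u p.2| := by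
          rw [lintegral_finsetSum]
          · refine Finset.sum_congr rfl fun p _ => ?_
            rw [lintegral_const_mul _ (measurable_one.indicator measurableSet_Ico),
              lintegral_indicator_one measurableSet_Ico, Real.volume_Ico, max_sub_min_eq_abs']
          · intro p _
            exact (measurable_one.indicator measurableSet_Ico).const_mul _
      _ ≤ ENNReal.ofReal (planCost α γ) := by
          rw [planCost_eq_sum (Finset.Subset.refl _), ENNReal.ofReal_sum_of_nonneg]
          · refine Finset.sum_le_sum fun p _ => ?_
            rw [ENNReal.ofReal_mul (wt_nonneg (hγ.1 p))]
            gcongr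
            rw [dist_comm u, dist_comm u]
            exact abs_dist_sub_le _ _ _
          · intro p _
            exact mul_nonneg (wt_nonneg (hγ.1 p)) dist_nonneg
  exact (ENNReal.ofReal_le_ofReal_iff (planCost_nonneg hγ.1)).1 hlin

end Plans

/-! ### `J_α` is a quasimetric -/

section TransportQuasimetric

variable {Y : Type*}

lemma Plan.swap {a b : Y →₀ ℝ} {γ : Y × Y →₀ ℝ} (hγ : γ ∈ Plan a b) :
    γ.mapDomain Prod.swap ∈ Plan b a := by
  refine ⟨fun p => ?_, ?_, ?_⟩
  · rw [← Prod.swap_swap p, Finsupp.mapDomain_apply Prod.swap_injective]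
    exact hγ.1 _
  · rw [← Finsupp.mapDomain_comp]; exact hγ.2.2
  · rw [← Finsupp.mapDomain_comp]; exact hγ.2.1

lemma single_move_mem_plan {s : Y →₀ ℝ} (hs : ∀ y, 0 ≤ s y) {m : ℝ} (hm : 0 ≤ m) (u v : Y) :
    s.mapDomain (fun z => (z, z)) + Finsupp.single (u, v) m ∈
      Plan (s + Finsupp.single u m) (s + Finsupp.single v m) := by
  have hinj : Function.Injective (fun z : Y => (z, z)) := fun x y h => congrArg Prod.fst h
  refine ⟨fun p => add_nonneg ?_ ?_, ?_, ?_⟩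
  · by_cases hp : p ∈ Set.range (fun z : Y => (z, z))
    · obtain ⟨z, rfl⟩ := hp
      rw [Finsupp.mapDomain_apply hinj]; exact hs z
    · rw [Finsupp.mapDomain_of_notMem_range _ _ hp]
  · classical
    rw [Finsupp.single_apply]; split_ifs; exacts [hm, le_rfl]
  · rw [Finsupp.mapDomain_add, ← Finsupp.mapDomain_comp, Finsupp.mapDomain_single]
    congr 1; exact Finsupp.mapDomain_id
  · rw [Finsupp.mapDomain_add, ← Finsupp.mapDomain_comp, Finsupp.mapDomain_single]
    congr 1; exact Finsupp.mapDomain_id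

lemma pairing_indicator_singleton (z : Y) (a : Y →₀ ℝ) :
    pairing (({z} : Set Y).indicator 1) a = a z := by
  classical
  rw [pairing_eq_sum _ (Finset.subset_insert z a.support),
    Finset.sum_eq_single_of_mem z (Finset.mem_insert_self _ _)]
  · simp
  · intro y _ hy; simp [hy]

variable [MetricSpace Y]

lemma plan_nonempty {a b : Y →₀ ℝ} (ha : ∀ y, 0 ≤ a y) (ha1 : (a.sum fun _ m => m) = 1)
    (hb : ∀ y, 0 ≤ b y) (hb1 : (b.sum fun _ m => m) = 1) : (Plan a b).Nonempty := by
  classical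
  obtain ⟨γ, hγ, -⟩ := exists_plan_of_matrix (α := 1) (a := a) (b := b) (S := a.support)
    (T := b.support) (fun x y => a x * b y) (fun x _ y _ => mul_nonneg (ha x) (hb y))
    subset_rfl subset_rfl
    (fun x _ => by rw [← Finset.mul_sum]; exact (congrArg (a x * ·) hb1).trans (mul_one _))
    (fun y _ => by rw [← Finset.sum_mul]; exact (congrArg (· * b y) ha1).trans (one_mul _))
  exact ⟨γ, hγ⟩

lemma planCost_swap {α : ℝ} (γ : Y × Y →₀ ℝ) :
    planCost α (γ.mapDomain Prod.swap) = planCost α γ := by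
  rw [planCost, planCost, Finsupp.sum_mapDomain_index_inj Prod.swap_injective]
  simp [dist_comm]

/-- The resting mass lies on the diagonal, where it costs nothing; if `u ≠ v`, it does not add to
the entry at `(u, v)`. -/
lemma planCost_single_move {α : ℝ} {s : Y →₀ ℝ} {m : ℝ} (u v : Y) :
    planCost α (s.mapDomain (fun z => (z, z)) + Finsupp.single (u, v) m) = wt α m * dist u v := by
  classical
  set γ := s.mapDomain (fun z => (z, z)) + Finsupp.single (u, v) m with hγ
  have hoff : ∀ p : Y × Y, p.1 ≠ p.2 → s.mapDomain (fun z => (z, z)) p = 0 := fun p hp =>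
    Finsupp.mapDomain_of_notMem_range _ _ (by rintro ⟨z, rfl⟩; exact hp rfl)
  rw [planCost_eq_sum (Finset.subset_insert (u, v) γ.support),
    Finset.sum_eq_single_of_mem (u, v) (Finset.mem_insert_self _ _)]
  · by_cases huv : u = v
    · simp [huv]
    · rw [hγ, Finsupp.add_apply, hoff _ huv, zero_add, Finsupp.single_eq_same]
  · intro p _ hp
    by_cases h : p.1 = p.2
    · simp [h]
    · rw [hγ, Finsupp.add_apply, hoff _ h, zero_add, Finsupp.single_eq_of_ne hp]; simp

variable {α : ℝ} {N : ℕ}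

lemma transportQuasimetric_le {a b : AtomicProb N Y} {γ : Y × Y →₀ ℝ} (hγ : γ ∈ Plan a.1 b.1) :
    transportQuasimetric α a b ≤ planCost α γ :=
  csInf_le ⟨0, by rintro _ ⟨γ, hγ, rfl⟩; exact planCost_nonneg hγ.1⟩ ⟨γ, hγ, rfl⟩

lemma le_transportQuasimetric {a b : AtomicProb N Y} {c : ℝ}
    (h : ∀ γ ∈ Plan a.1 b.1, c ≤ planCost α γ) : c ≤ transportQuasimetric α a b :=
  le_csInf ((plan_nonempty a.2.1 a.2.2.1 b.2.1 b.2.2.1).image _)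
    (by rintro _ ⟨γ, hγ, rfl⟩; exact h γ hγ)

lemma transportQuasimetric_nonneg (a b : AtomicProb N Y) : 0 ≤ transportQuasimetric α a b :=
  le_transportQuasimetric fun _ hγ => planCost_nonneg hγ.1

lemma transportQuasimetric_symm (a b : AtomicProb N Y) :
    transportQuasimetric α a b = transportQuasimetric α b a :=
  le_antisymm
    (le_transportQuasimetric fun γ hγ => planCost_swap (α := α) γ ▸
      transportQuasimetric_le (Plan.swap hγ))
    (le_transportQuasimetric fun γ hγ => planCost_swap (α := α) γ ▸
      transportQuasimetric_le (Plan.swap hγ))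

lemma transportQuasimetric_cut (hα : 0 ≤ α) (hα1 : α ≤ 1) (a b : AtomicProb N Y) (A : Set Y)
    {δ : ℝ} (hδ : 0 ≤ δ)
    (h : ∀ p ∈ a.1.support, ∀ q ∈ b.1.support, ¬ (p ∈ A ↔ q ∈ A) → δ ≤ dist p q) :
    δ * wt α |pairing (A.indicator 1) a.1 - pairing (A.indicator 1) b.1| ≤
      transportQuasimetric α a b :=
  le_transportQuasimetric fun _ hγ => wt_cut_mul_le_planCost hα hα1 hγ A hδ h

lemma transportQuasimetric_single_move (hα : 0 ≤ α) (hα1 : α ≤ 1) {a b : AtomicProb N Y}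
    {s : Y →₀ ℝ} (hs : ∀ y, 0 ≤ s y) {m : ℝ} (hm : 0 ≤ m) {u v : Y}
    (ha : a.1 = s + Finsupp.single u m) (hb : b.1 = s + Finsupp.single v m) :
    transportQuasimetric α a b = wt α m * dist u v := by
  apply le_antisymm
  · rw [← planCost_single_move (s := s)]
    exact transportQuasimetric_le (ha ▸ hb ▸ single_move_mem_plan hs hm u v)
  · exact le_transportQuasimetric fun γ hγ =>
      wt_mul_dist_le_planCost hα hα1 hm (ha ▸ hb ▸ hγ)

lemma transportQuasimetric_self (hα : 0 ≤ α) (hα1 : α ≤ 1) [Nonempty Y] (a : AtomicProb N Y) :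
    transportQuasimetric α a a = 0 := by
  obtain ⟨u⟩ := ‹Nonempty Y›
  -- The whole measure is the rest of a move of mass 0.
  rw [transportQuasimetric_single_move hα hα1 (s := a.1) a.2.1 le_rfl (u := u) (v := u)] <;> simp

lemma exists_pos_separation (F : Finset Y) :
    ∃ δ > 0, ∀ p ∈ F, ∀ q ∈ F, p ≠ q → δ ≤ dist p q := by
  classical
  rcases F.offDiag.eq_empty_or_nonempty with h | h
  · refine ⟨1, one_pos, fun p hp q hq hpq => ?_⟩
    have : (p, q) ∈ F.offDiag := Finset.mem_offDiag.2 ⟨hp, hq, hpq⟩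
    simp [h] at this
  · obtain ⟨x, hx, hmin⟩ := F.offDiag.exists_min_image (fun p => dist p.1 p.2) h
    exact ⟨dist x.1 x.2, dist_pos.2 (Finset.mem_offDiag.1 hx).2.2, fun p hp q hq hpq =>
      hmin (p, q) (Finset.mem_offDiag.2 ⟨hp, hq, hpq⟩)⟩

/-- Cutting at a point `z` where the masses differ costs at least the least distance between
distinct atoms times a positive weight. -/
lemma eq_of_transportQuasimetric_eq_zero (hα : 0 ≤ α) (hα1 : α ≤ 1) {a b : AtomicProb N Y}
    (h : transportQuasimetric α a b = 0) : a = b := by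
  classical
  by_contra hab
  obtain ⟨z, hz⟩ : ∃ z, a.1 z ≠ b.1 z := by
    by_contra! hall
    exact hab (Subtype.ext (Finsupp.ext hall))
  obtain ⟨δ, hδ, hsep⟩ := exists_pos_separation (a.1.support ∪ b.1.support)
  have h1 := transportQuasimetric_cut hα hα1 a b {z} hδ.le fun p hp q hq hpq =>
    hsep p (Finset.mem_union_left _ hp) q (Finset.mem_union_right _ hq)
      (by rintro rfl; exact hpq Iff.rfl)
  rw [h, pairing_indicator_singleton, pairing_indicator_singleton] at h1
  have := mul_pos hδ (wt_pos (α := α) (abs_pos.2 (sub_ne_zero.2 hz)))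
  linarith

-- What comes from `x` to `z` is passed on to the `y` in proportion to `γ' (z, y)`. Each product is
-- at most either of its two factors in mass, and each entry of one plan recurs once for every atom
-- at the far end of the other; hence the cardinalities.
open Classical in
lemma exists_glued_plan (hα : 0 ≤ α) (hα1 : α ≤ 1) {a b c : Y →₀ ℝ} (hc : ∀ z, 0 ≤ c z)
    {γ γ' : Y × Y →₀ ℝ} (hγ : γ ∈ Plan a c) (hγ' : γ' ∈ Plan c b) :
    ∃ η ∈ Plan a b, planCost α η ≤
      b.support.card * planCost α γ + a.support.card * planCost α γ' := by
  have hc' : ∀ z ∈ c.support, 0 < c z := fun z hz =>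
    lt_of_le_of_ne (hc z) (Ne.symm (Finsupp.mem_support_iff.1 hz))
  have ht : ∀ x y z, 0 ≤ γ (x, z) * γ' (z, y) / c z := fun x y z =>
    div_nonneg (mul_nonneg (hγ.1 _) (hγ'.1 _)) (hc z)
  obtain ⟨η, hη, hcost⟩ := exists_plan_of_matrix (α := α) (a := a) (b := b) (S := a.support)
    (T := b.support) (fun x y => ∑ z ∈ c.support, γ (x, z) * γ' (z, y) / c z)
    (fun x _ y _ => Finset.sum_nonneg fun z _ => ht x y z) subset_rfl subset_rfl
    (fun x hx => by
      rw [Finset.sum_comm, ← Plan.sum_right hγ hx]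
      refine Finset.sum_congr rfl fun z hz => ?_
      rw [← Finset.sum_div, ← Finset.mul_sum, Plan.sum_right hγ' hz,
        mul_div_cancel_right₀ _ (hc' z hz).ne'])
    (fun y hy => by
      rw [Finset.sum_comm, ← Plan.sum_left hγ' hy]
      refine Finset.sum_congr rfl fun z hz => ?_
      rw [← Finset.sum_div, ← Finset.sum_mul, Plan.sum_left hγ hz,
        mul_div_cancel_left₀ _ (hc' z hz).ne'])
  refine ⟨η, hη, ?_⟩
  have hw1 : ∀ x y, ∀ z ∈ c.support, wt α (γ (x, z) * γ' (z, y) / c z) ≤ wt α (γ (x, z)) := by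
    intro x y z hz
    refine wt_mono hα (ht x y z) ?_
    rw [div_le_iff₀ (hc' z hz)]
    refine mul_le_mul_of_nonneg_left ?_ (hγ.1 _)
    have := apply_le_mapDomain hγ'.1 Prod.fst (z, y)
    rwa [hγ'.2.1] at this
  have hw2 : ∀ x y, ∀ z ∈ c.support, wt α (γ (x, z) * γ' (z, y) / c z) ≤ wt α (γ' (z, y)) := by
    intro x y z hz
    refine wt_mono hα (ht x y z) ?_
    rw [div_le_iff₀ (hc' z hz), mul_comm]
    refine mul_le_mul_of_nonneg_left ?_ (hγ'.1 _)
    have := apply_le_mapDomain hγ.1 Prod.snd (x, z)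
    rwa [hγ.2.2] at this
  have hle : ∀ x ∈ a.support, ∀ y ∈ b.support,
      wt α (∑ z ∈ c.support, γ (x, z) * γ' (z, y) / c z) * dist x y ≤
      (∑ z ∈ c.support, wt α (γ (x, z)) * dist x z) +
        ∑ z ∈ c.support, wt α (γ' (z, y)) * dist z y := by
    intro x _ y _
    rw [← Finset.sum_add_distrib]
    refine (mul_le_mul_of_nonneg_right (wt_sum_le hα hα1 _ _ fun z _ => ht x y z)
      dist_nonneg).trans ?_
    rw [Finset.sum_mul]
    refine Finset.sum_le_sum fun z hz => ?_
    have h0 := wt_nonneg (α := α) (ht x y z)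
    calc _ ≤ wt α (γ (x, z) * γ' (z, y) / c z) * (dist x z + dist z y) :=
          mul_le_mul_of_nonneg_left (dist_triangle _ _ _) h0
      _ ≤ _ := by
          rw [mul_add]
          exact add_le_add (mul_le_mul_of_nonneg_right (hw1 x y z hz) dist_nonneg)
            (mul_le_mul_of_nonneg_right (hw2 x y z hz) dist_nonneg)
  rw [hcost]
  refine (Finset.sum_le_sum fun x hx => Finset.sum_le_sum fun y hy => hle x hx y hy).trans ?_
  apply le_of_eq
  simp only [Finset.sum_add_distrib, Finset.sum_const, nsmul_eq_mul]
  rw [Plan.cost_eq hγ, Plan.cost_eq hγ', ← Finset.mul_sum]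
  congr 2
  rw [Finset.sum_comm]

lemma transportQuasimetric_triangle (hα : 0 ≤ α) (hα1 : α ≤ 1) (a b c : AtomicProb N Y) :
    transportQuasimetric α a b ≤
      N * (transportQuasimetric α a c + transportQuasimetric α c b) := by
  have hN : (0 : ℝ) ≤ N := Nat.cast_nonneg N
  have key : ∀ γ ∈ Plan a.1 c.1, ∀ γ' ∈ Plan c.1 b.1,
      transportQuasimetric α a b ≤ N * planCost α γ + N * planCost α γ' := by
    intro γ hγ γ' hγ'
    obtain ⟨η, hη, hle⟩ := exists_glued_plan hα hα1 c.2.1 hγ hγ'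
    refine (transportQuasimetric_le hη).trans (hle.trans (add_le_add ?_ ?_))
    · exact mul_le_mul_of_nonneg_right (Nat.cast_le.2 b.2.2.2) (planCost_nonneg hγ.1)
    · exact mul_le_mul_of_nonneg_right (Nat.cast_le.2 a.2.2.2) (planCost_nonneg hγ'.1)
  -- The bound `key` is minimized over one plan after the other, dividing by `N`; `N = 0` is
  -- therefore separate.
  rcases hN.eq_or_lt with h0 | hpos
  · obtain ⟨γ, hγ⟩ := plan_nonempty a.2.1 a.2.2.1 c.2.1 c.2.2.1
    obtain ⟨γ', hγ'⟩ := plan_nonempty c.2.1 c.2.2.1 b.2.1 b.2.2.1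
    simpa [← h0] using key γ hγ γ' hγ'
  rw [mul_add]
  have h2 : ∀ γ' ∈ Plan c.1 b.1, transportQuasimetric α a b - N * planCost α γ' ≤
      N * transportQuasimetric α a c := by
    intro γ' hγ'
    have : (transportQuasimetric α a b - N * planCost α γ') / N ≤ transportQuasimetric α a c :=
      le_transportQuasimetric fun γ hγ => by
        rw [div_le_iff₀' hpos]; linarith [key γ hγ γ' hγ']
    rwa [div_le_iff₀' hpos] at this
  have h3 : (transportQuasimetric α a b - N * transportQuasimetric α a c) / N ≤
      transportQuasimetric α c b :=
    le_transportQuasimetric fun γ' hγ' => by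
      rw [div_le_iff₀' hpos]; linarith [h2 γ' hγ']
  rw [div_le_iff₀' hpos] at h3
  linarith

lemma isQuasimetric_transportQuasimetric [Nonempty Y] (hα : 0 ≤ α) (hα1 : α ≤ 1) (hN : 1 ≤ N) :
    IsQuasimetric (transportQuasimetric α : AtomicProb N Y → AtomicProb N Y → ℝ) where
  nonempty := by
    classical
    obtain ⟨u⟩ := ‹Nonempty Y›
    refine ⟨Finsupp.single u 1, fun y => ?_, by simp, ?_⟩
    · rw [Finsupp.single_apply]; split_ifs <;> norm_num
    · exact (Finset.card_le_card Finsupp.support_single_subset).trans (by simpa using hN)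
  nonneg := transportQuasimetric_nonneg
  eq_zero_iff a b := ⟨eq_of_transportQuasimetric_eq_zero hα hα1,
    fun h => h ▸ transportQuasimetric_self hα hα1 a⟩
  symm := transportQuasimetric_symm
  relaxed_triangle := ⟨N, by exact_mod_cast hN, transportQuasimetric_triangle hα hα1⟩

end TransportQuasimetric

/-! ### Chains of elementary moves -/

section Chains

variable {Y : Type*}

/-- The mass `m` is moved from `x` to `y`, leaving `s` at rest. The bound on `s` ensures that
there are at most `N` atoms all along the way. -/
structure IsMoveBy (N : ℕ) (s : Y →₀ ℝ) (m : ℝ) (x y : Y) (a b : Y →₀ ℝ) : Prop where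
  rest_nonneg : ∀ z, 0 ≤ s z
  mass_nonneg : 0 ≤ m
  card_lt : s.support.card < N
  source : a = s + Finsupp.single x m
  target : b = s + Finsupp.single y m

lemma IsMoveBy.symm {N : ℕ} {s : Y →₀ ℝ} {m : ℝ} {x y : Y} {a b : Y →₀ ℝ}
    (h : IsMoveBy N s m x y a b) : IsMoveBy N s m y x b a :=
  ⟨h.rest_nonneg, h.mass_nonneg, h.card_lt, h.target, h.source⟩

open Classical in
lemma support_add_single {s : Y →₀ ℝ} (hs : ∀ z, 0 ≤ s z) {m : ℝ} (hm : 0 ≤ m) (x : Y) :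
    (s + Finsupp.single x m).support = if m = 0 then s.support else insert x s.support := by
  split_ifs with h
  · simp [h]
  · have hm' : 0 < m := lt_of_le_of_ne hm (Ne.symm h)
    ext z
    by_cases hz : z = x
    · subst hz
      simp only [Finsupp.mem_support_iff, Finsupp.add_apply, Finsupp.single_eq_same, ne_eq,
        Finset.mem_insert, true_or, iff_true]
      exact (add_pos_of_nonneg_of_pos (hs z) hm').ne'
    · simp [Finsupp.single_eq_of_ne hz, hz]

lemma card_support_add_single_le {s : Y →₀ ℝ} {N : ℕ} (hs : s.support.card < N) (x : Y) (m : ℝ) :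
    (s + Finsupp.single x m).support.card ≤ N := by
  classical
  refine (Finset.card_le_card Finsupp.support_add).trans ((Finset.card_union_le _ _).trans ?_)
  have := Finset.card_le_card (Finsupp.support_single_subset (a := x) (b := m))
  rw [Finset.card_singleton] at this
  omega

lemma IsMoveBy.nonneg_target {N : ℕ} {s : Y →₀ ℝ} {m : ℝ} {x y : Y} {a b : Y →₀ ℝ}
    (h : IsMoveBy N s m x y a b) (z : Y) : 0 ≤ b z := by
  classical
  rw [h.target, Finsupp.add_apply, Finsupp.single_apply]
  split_ifs
  · exact add_nonneg (h.rest_nonneg z) h.mass_nonneg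
  · simpa using h.rest_nonneg z

lemma card_support_sum_single_le {ι : Type*} (I : Finset ι) (μ : ι → ℝ) (r : ι → Y) :
    (∑ j ∈ I, Finsupp.single (r j) (μ j)).support.card ≤ I.card := by
  classical
  refine (Finset.card_le_card (Finsupp.support_finsetSum.trans
    (Finset.biUnion_mono fun j _ => Finsupp.support_single_subset))).trans ?_
  rw [Finset.biUnion_singleton]
  exact Finset.card_image_le

lemma single_apply_nonneg {m : ℝ} (hm : 0 ≤ m) (x z : Y) : 0 ≤ Finsupp.single x m z := by
  classical
  rw [Finsupp.single_apply]; split_ifs; exacts [hm, le_rfl]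

variable [MetricSpace Y]

/-- `Chain N α k a b c`: there is a sequence of `k` moves from `a` to `b` of total cost `c`. -/
inductive Chain (N : ℕ) (α : ℝ) : ℕ → (Y →₀ ℝ) → (Y →₀ ℝ) → ℝ → Prop
  | nil (a : Y →₀ ℝ) : Chain N α 0 a a 0
  | snoc {k : ℕ} {a b b' s : Y →₀ ℝ} {m c : ℝ} {x y : Y} (h : Chain N α k a b c)
      (h' : IsMoveBy N s m x y b b') : Chain N α (k + 1) a b' (c + wt α m * dist x y)

variable {N : ℕ} {α : ℝ}

lemma IsMoveBy.chain {s : Y →₀ ℝ} {m : ℝ} {x y : Y} {a b : Y →₀ ℝ}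
    (h : IsMoveBy N s m x y a b) : Chain N α 1 a b (wt α m * dist x y) := by
  simpa using Chain.snoc (Chain.nil (N := N) (α := α) a) h

lemma Chain.trans {k l : ℕ} {a b d : Y →₀ ℝ} {c c' : ℝ} (h : Chain N α k a b c)
    (h' : Chain N α l b d c') : Chain N α (k + l) a d (c + c') := by
  induction h' with
  | nil => simpa using h
  | snoc _ hm ih => rw [← add_assoc, ← add_assoc]; exact (ih h).snoc hm

lemma Chain.symm {k : ℕ} {a b : Y →₀ ℝ} {c : ℝ} (h : Chain N α k a b c) :
    Chain N α k b a c := by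
  induction h with
  | nil a => exact .nil a
  | snoc _ hm ih =>
    rw [add_comm, add_comm _ (wt _ _ * _), dist_comm]
    exact (IsMoveBy.chain hm.symm).trans ih

lemma Chain.cost_nonneg {k : ℕ} {a b : Y →₀ ℝ} {c : ℝ} (h : Chain N α k a b c) : 0 ≤ c := by
  induction h with
  | nil a => exact le_rfl
  | snoc _ hm ih => exact add_nonneg ih (mul_nonneg (wt_nonneg hm.mass_nonneg) dist_nonneg)

/-- Masses can be moved one at a time if there is always room for the moving atom. -/
lemma chain_of_family {ι : Type*} [DecidableEq ι] (I : Finset ι) (μ : ι → ℝ) (u v : ι → Y)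
    (hμ : ∀ i ∈ I, 0 ≤ μ i)
    (hcard : ∀ i ∈ I, ∀ r : ι → Y, (∀ j ∈ I, r j = u j ∨ r j = v j) →
      (∑ j ∈ I.erase i, Finsupp.single (r j) (μ j)).support.card < N) :
    Chain N α I.card (∑ i ∈ I, Finsupp.single (u i) (μ i)) (∑ i ∈ I, Finsupp.single (v i) (μ i))
      (∑ i ∈ I, wt α (μ i) * dist (u i) (v i)) := by
  -- `S` is the set of masses already moved.
  have key : ∀ S ⊆ I, Chain N α S.card (∑ i ∈ I, Finsupp.single (u i) (μ i))
      (∑ i ∈ I, Finsupp.single (if i ∈ S then v i else u i) (μ i))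
      (∑ i ∈ S, wt α (μ i) * dist (u i) (v i)) := by
    intro S
    induction S using Finset.induction_on with
    | empty => intro _; simpa using Chain.nil _
    | insert i S hi ih =>
      intro hS
      have hiI : i ∈ I := hS (Finset.mem_insert_self i S)
      have h1 := ih ((Finset.subset_insert i S).trans hS)
      rw [Finset.card_insert_of_notMem hi, Finset.sum_insert hi, add_comm (wt _ _ * _)]
      refine h1.snoc (s := ∑ j ∈ I.erase i, Finsupp.single (if j ∈ S then v j else u j) (μ j))
        ⟨fun z => ?_, hμ i hiI, hcard i hiI _ fun j _ => ?_, ?_, ?_⟩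
      · rw [Finsupp.finsetSum_apply]
        refine Finset.sum_nonneg fun j hj => ?_
        exact single_apply_nonneg (hμ j (Finset.mem_of_mem_erase hj)) _ _
      · split_ifs <;> simp
      · rw [← Finset.sum_erase_add _ _ hiI]
        simp [hi]
      · rw [← Finset.sum_erase_add _ _ hiI]
        congr 1
        · refine Finset.sum_congr rfl fun j hj => ?_
          simp [Finset.ne_of_mem_erase hj]
        · simp
  convert key I subset_rfl using 1
  exact Finset.sum_congr rfl fun i hi => by rw [if_pos hi]

/-! ### Networks: chains of moves with all their data -/

/-- A sequence of `L` moves from `A` to `B`. -/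
structure Network (Y : Type*) (N L : ℕ) (A B : Y →₀ ℝ) where
  state : ℕ → Y →₀ ℝ
  rest : ℕ → Y →₀ ℝ
  mass : ℕ → ℝ
  tail : ℕ → Y
  head : ℕ → Y
  isMoveBy : ∀ l < L, IsMoveBy N (rest l) (mass l) (tail l) (head l) (state l) (state (l + 1))
  state_zero : state 0 = A
  state_last : state L = B

namespace Network

variable {L : ℕ} {A B : Y →₀ ℝ}

/-- The total cost of the moves. -/
def cost (α : ℝ) (T : Network Y N L A B) : ℝ :=
  ∑ l ∈ Finset.range L, wt α (T.mass l) * dist (T.tail l) (T.head l)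

open Classical in
/-- The indices of the moves that change something. -/
def nontrivial {Y : Type*} {A B : Y →₀ ℝ} (T : Network Y N L A B) : Finset ℕ :=
  {l ∈ Finset.range L | T.mass l ≠ 0 ∧ T.tail l ≠ T.head l}

lemma mem_nontrivial {Y : Type*} {A B : Y →₀ ℝ} {T : Network Y N L A B} {l : ℕ} :
    l ∈ T.nontrivial ↔ l < L ∧ T.mass l ≠ 0 ∧ T.tail l ≠ T.head l := by
  simp [nontrivial]

-- Moves that change nothing cost nothing and are skipped, so the length of the chain counts only
-- nontrivial moves.
open Classical in
lemma chain_take (T : Network Y N L A B) (n : ℕ) (hn : n ≤ L) :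
    Chain N α ({l ∈ Finset.range n | T.mass l ≠ 0 ∧ T.tail l ≠ T.head l}).card A (T.state n)
      (∑ l ∈ Finset.range n, wt α (T.mass l) * dist (T.tail l) (T.head l)) := by
  induction n with
  | zero => rw [T.state_zero]; simpa using Chain.nil A
  | succ n ih =>
    have h1 := ih (by omega)
    have h2 := T.isMoveBy n (by omega)
    rw [Finset.sum_range_succ, Finset.range_add_one, Finset.filter_insert]
    split_ifs with h
    · rw [Finset.card_insert_of_notMem (by simp)]
      exact h1.snoc h2
    · have h3 : wt α (T.mass n) * dist (T.tail n) (T.head n) = 0 := by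
        by_cases hm : T.mass n = 0
        · simp [hm]
        · have : T.tail n = T.head n := by tauto
          simp [this]
      have h4 : T.state (n + 1) = T.state n := by
        rw [h2.source, h2.target]
        by_cases hm : T.mass n = 0
        · simp [hm]
        · have : T.tail n = T.head n := by tauto
          simp [this]
      rw [h3, add_zero, h4]
      exact h1

lemma chain (T : Network Y N L A B) : Chain N α T.nontrivial.card A B (T.cost α) := by
  have := T.chain_take (α := α) L le_rfl
  rwa [T.state_last] at this

end Network

lemma Chain.exists_network [Nonempty Y] {k : ℕ} {A B : Y →₀ ℝ} {c : ℝ} (h : Chain N α k A B c) :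
    ∃ T : Network Y N k A B, T.cost α = c := by
  induction h with
  | nil a =>
    obtain ⟨u⟩ := ‹Nonempty Y›
    exact ⟨⟨fun _ => a, fun _ => 0, fun _ => 0, fun _ => u, fun _ => u, by simp, rfl, rfl⟩,
      by simp [Network.cost]⟩
  | @snoc k a b b' s m c x y _ hm ih =>
    obtain ⟨T, hT⟩ := ih
    refine ⟨⟨fun l => if l ≤ k then T.state l else b', fun l => if l < k then T.rest l else s,
      fun l => if l < k then T.mass l else m, fun l => if l < k then T.tail l else x,
      fun l => if l < k then T.head l else y, fun l hl => ?_, ?_, ?_⟩, ?_⟩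
    · rcases (Nat.lt_succ_iff.1 hl).lt_or_eq with h | rfl
      · have h1 : l + 1 ≤ k := h
        simpa [h, h.le, h1] using T.isMoveBy l h
      · simpa [T.state_last] using hm
    · simp [T.state_zero]
    · simp
    · subst hT
      simp only [Network.cost]
      rw [Finset.sum_range_succ]
      congr 1
      · refine Finset.sum_congr rfl fun l hl => ?_
        simp [Finset.mem_range.1 hl]
      · simp

end Chains

namespace Network

/-! ### Flows on the edges of a network -/

section Flows

variable {Y : Type*} {N L : ℕ} {A B : Y →₀ ℝ}

open Classical in
/-- The edges of the time-expanded graph which carry mass: `Sum.inl l` is the `l`-th move, and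
`Sum.inr ⟨l, z⟩` is the mass at rest at `z` during the `l`-th move. -/
def edges (T : Network Y N L A B) : Finset (ℕ ⊕ (Σ _ : ℕ, Y)) :=
  Finset.disjSum {l ∈ Finset.range L | T.mass l ≠ 0}
    ((Finset.range L).sigma fun l => (T.rest l).support)

/-- The vertices of the time-expanded graph: the atoms of the successive states. -/
def vertices (T : Network Y N L A B) : Finset (Σ _ : ℕ, Y) :=
  (Finset.range (L + 1)).sigma fun l => (T.state l).support

/-- The mass on an edge. -/
def val (T : Network Y N L A B) : ℕ ⊕ (Σ _ : ℕ, Y) → ℝ :=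
  Sum.elim T.mass fun p => T.rest p.1 p.2

variable {T : Network Y N L A B}

lemma inl_mem_edges {l : ℕ} : Sum.inl l ∈ T.edges ↔ l < L ∧ T.mass l ≠ 0 := by
  simp [edges]

lemma inr_mem_edges {l : ℕ} {z : Y} : Sum.inr ⟨l, z⟩ ∈ T.edges ↔ l < L ∧ T.rest l z ≠ 0 := by
  simp [edges]

lemma mem_vertices {l : ℕ} {z : Y} : ⟨l, z⟩ ∈ T.vertices ↔ l ≤ L ∧ T.state l z ≠ 0 := by
  simp [vertices]

lemma val_pos {e : ℕ ⊕ (Σ _ : ℕ, Y)} (he : e ∈ T.edges) : 0 < T.val e := by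
  rcases e with l | ⟨l, z⟩
  · obtain ⟨h1, h2⟩ := inl_mem_edges.1 he
    exact lt_of_le_of_ne (T.isMoveBy l h1).mass_nonneg h2.symm
  · obtain ⟨h1, h2⟩ := inr_mem_edges.1 he
    exact lt_of_le_of_ne ((T.isMoveBy l h1).rest_nonneg z) h2.symm

open Classical in
/-- What `U` brings to `z` in the `l`-th move. -/
def inflow (T : Network Y N L A B) (U : ℕ ⊕ (Σ _ : ℕ, Y) → ℝ) (l : ℕ) (z : Y) : ℝ :=
  U (Sum.inr ⟨l, z⟩) + if T.head l = z then U (Sum.inl l) else 0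

open Classical in
/-- What `U` takes from `z` in the `l`-th move. -/
def outflow (T : Network Y N L A B) (U : ℕ ⊕ (Σ _ : ℕ, Y) → ℝ) (l : ℕ) (z : Y) : ℝ :=
  U (Sum.inr ⟨l, z⟩) + if T.tail l = z then U (Sum.inl l) else 0

/-- A signed flow on the edges of `T` that does not change the initial and the final state. -/
structure IsFlow (T : Network Y N L A B) (U : ℕ ⊕ (Σ _ : ℕ, Y) → ℝ) : Prop where
  zero_off : ∀ e ∉ T.edges, U e = 0
  start : 0 < L → ∀ z, T.outflow U 0 z = 0
  step : ∀ l, l + 1 < L → ∀ z, T.inflow U l z = T.outflow U (l + 1) z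
  last : ∀ l, l + 1 = L → ∀ z, T.inflow U l z = 0
  total : ∀ l < L, ∑ z ∈ (T.rest l).support, U (Sum.inr ⟨l, z⟩) + U (Sum.inl l) = 0

lemma IsFlow.neg {U : ℕ ⊕ (Σ _ : ℕ, Y) → ℝ} (h : T.IsFlow U) : T.IsFlow (-U) := by
  have ho : ∀ l z, T.outflow (-U) l z = - T.outflow U l z := fun l z => by
    unfold outflow; split_ifs <;> simp; ring
  have hi : ∀ l z, T.inflow (-U) l z = - T.inflow U l z := fun l z => by
    unfold inflow; split_ifs <;> simp; ring
  refine ⟨fun e he => ?_, fun hL z => ?_, fun l hl z => ?_, fun l hl z => ?_, fun l hl => ?_⟩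
  · simp [h.zero_off e he]
  · rw [ho, h.start hL z, neg_zero]
  · rw [ho, hi, h.step l hl z]
  · rw [hi, h.last l hl z, neg_zero]
  · have := h.total l hl
    simp only [Pi.neg_apply, Finset.sum_neg_distrib]
    linarith

/-- The flow sums to zero on each level, so it vanishes if it has no negative value. Applied to `U`
and `-U`, this yields edges to be emptied in both directions. -/
lemma IsFlow.exists_neg {U : ℕ ⊕ (Σ _ : ℕ, Y) → ℝ} (h : T.IsFlow U) (h0 : U ≠ 0) :
    ∃ e ∈ T.edges, U e < 0 := by
  by_contra! hU
  have hU' : ∀ e, 0 ≤ U e := fun e => by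
    by_cases he : e ∈ T.edges
    · exact hU e he
    · exact (h.zero_off e he).ge
  apply h0
  funext e
  by_cases he : e ∈ T.edges
  swap
  · exact h.zero_off e he
  have hl : ∀ l < L, (∀ z ∈ (T.rest l).support, U (Sum.inr ⟨l, z⟩) = 0) ∧ U (Sum.inl l) = 0 := by
    intro l hl
    have h1 := h.total l hl
    have h2 : 0 ≤ ∑ z ∈ (T.rest l).support, U (Sum.inr ⟨l, z⟩) :=
      Finset.sum_nonneg fun z _ => hU' _
    have h3 := hU' (Sum.inl l)
    refine ⟨(Finset.sum_eq_zero_iff_of_nonneg fun z _ => hU' _).1 (by linarith), by linarith⟩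
  rcases e with l | ⟨l, z⟩
  · exact (hl l (inl_mem_edges.1 he).1).2
  · obtain ⟨h1, h2⟩ := inr_mem_edges.1 he
    exact (hl l h1).1 z (Finsupp.mem_support_iff.2 h2)

/-- The least ratio `v e / (- U e)` over the negative entries is the first time at which an edge is
empty. -/
lemma exists_pos_hitting {ι : Type*} {E : Finset ι} {v U : ι → ℝ} (hv : ∀ e ∈ E, 0 < v e)
    (hU : ∃ e ∈ E, U e < 0) :
    ∃ ε > 0, (∀ e ∈ E, 0 ≤ v e + ε * U e) ∧ ∃ e ∈ E, v e + ε * U e = 0 := by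
  classical
  obtain ⟨e₁, he₁, hU₁⟩ := hU
  obtain ⟨e₀, he₀, hmin⟩ := (E.filter fun e => U e < 0).exists_min_image (fun e => v e / (- U e))
    ⟨e₁, Finset.mem_filter.2 ⟨he₁, hU₁⟩⟩
  obtain ⟨he₀, hU₀⟩ := Finset.mem_filter.1 he₀
  have hε : 0 < v e₀ / (- U e₀) := div_pos (hv e₀ he₀) (by linarith)
  refine ⟨v e₀ / (- U e₀), hε, fun e he => ?_, e₀, he₀, ?_⟩
  · by_cases hUe : U e < 0
    · have := hmin e (Finset.mem_filter.2 ⟨he, hUe⟩)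
      rw [le_div_iff₀ (by linarith)] at this
      linarith
    · have := hv e he
      have := mul_nonneg hε.le (not_lt.1 hUe)
      linarith
  · have : U e₀ ≠ 0 := hU₀.ne
    field_simp
    ring

/-- The part of a flow at rest during the `l`-th move. -/
def flowRest (T : Network Y N L A B) {U : ℕ ⊕ (Σ _ : ℕ, Y) → ℝ} (h : T.IsFlow U) (l : ℕ) :
    Y →₀ ℝ :=
  Finsupp.onFinset (T.rest l).support (fun z => U (Sum.inr ⟨l, z⟩)) fun z hz => by
    by_contra hz'
    exact hz (h.zero_off _ fun he => (inr_mem_edges.1 he).2 (Finsupp.notMem_support_iff.1 hz'))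

lemma flowRest_apply {U : ℕ ⊕ (Σ _ : ℕ, Y) → ℝ} (h : T.IsFlow U) (l : ℕ) (z : Y) :
    T.flowRest h l z = U (Sum.inr ⟨l, z⟩) := rfl

/-- The change of the states caused by a flow. -/
def flowState (T : Network Y N L A B) {U : ℕ ⊕ (Σ _ : ℕ, Y) → ℝ} (h : T.IsFlow U) (l : ℕ) :
    Y →₀ ℝ :=
  if l < L then T.flowRest h l + Finsupp.single (T.tail l) (U (Sum.inl l)) else 0

lemma flowState_zero {U : ℕ ⊕ (Σ _ : ℕ, Y) → ℝ} (h : T.IsFlow U) : T.flowState h 0 = 0 := by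
  classical
  unfold flowState
  split_ifs with hL
  · ext z
    simpa [outflow, flowRest_apply, Finsupp.single_apply] using h.start hL z
  · rfl

lemma flowState_succ {U : ℕ ⊕ (Σ _ : ℕ, Y) → ℝ} (h : T.IsFlow U) {l : ℕ} (hl : l < L) :
    T.flowState h (l + 1) = T.flowRest h l + Finsupp.single (T.head l) (U (Sum.inl l)) := by
  classical
  unfold flowState
  split_ifs with hL
  · ext z
    simpa [outflow, inflow, flowRest_apply, Finsupp.single_apply] using (h.step l hL z).symm
  · ext z
    simpa [inflow, flowRest_apply, Finsupp.single_apply] using (h.last l (by omega) z).symm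

/-- Adding a multiple of a flow to a network. -/
def shift (T : Network Y N L A B) {U : ℕ ⊕ (Σ _ : ℕ, Y) → ℝ} (h : T.IsFlow U) (ε : ℝ)
    (hε : ∀ e ∈ T.edges, 0 ≤ T.val e + ε * U e) : Network Y N L A B where
  state l := T.state l + ε • T.flowState h l
  rest l := T.rest l + ε • T.flowRest h l
  mass l := T.mass l + ε * U (Sum.inl l)
  tail := T.tail
  head := T.head
  isMoveBy l hl := by
    have hm := T.isMoveBy l hl
    refine ⟨fun z => ?_, ?_, lt_of_le_of_lt (Finset.card_le_card fun z hz => ?_) hm.card_lt,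
      ?_, ?_⟩
    · by_cases he : Sum.inr ⟨l, z⟩ ∈ T.edges
      · exact hε _ he
      · simpa [flowRest_apply, h.zero_off _ he] using hm.rest_nonneg z
    · by_cases he : Sum.inl l ∈ T.edges
      · exact hε _ he
      · simpa [h.zero_off _ he] using hm.mass_nonneg
    -- A flow vanishes off the edges, so the support of the rest can only shrink and the bound on
    -- the atoms persists.
    · rw [Finsupp.mem_support_iff]
      intro h0
      refine Finsupp.mem_support_iff.1 hz ?_
      have : Sum.inr ⟨l, z⟩ ∉ T.edges := fun he => (inr_mem_edges.1 he).2 h0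
      simp [flowRest_apply, h.zero_off _ this, h0]
    · rw [hm.source, flowState, if_pos hl, smul_add, Finsupp.smul_single, smul_eq_mul,
        Finsupp.single_add]
      abel
    · rw [hm.target, flowState_succ h hl, smul_add, Finsupp.smul_single, smul_eq_mul,
        Finsupp.single_add]
      abel
  state_zero := by rw [flowState_zero, smul_zero, add_zero, T.state_zero]
  state_last := by rw [flowState, if_neg (lt_irrefl _), smul_zero, add_zero, T.state_last]

lemma val_shift {U : ℕ ⊕ (Σ _ : ℕ, Y) → ℝ} (h : T.IsFlow U) (ε : ℝ)
    (hε : ∀ e ∈ T.edges, 0 ≤ T.val e + ε * U e) (e : ℕ ⊕ (Σ _ : ℕ, Y)) :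
    (T.shift h ε hε).val e = T.val e + ε * U e := by
  rcases e with l | ⟨l, z⟩ <;> rfl

lemma mem_edges_iff {e : ℕ ⊕ (Σ _ : ℕ, Y)} :
    e ∈ T.edges ↔ Sum.elim id Sigma.fst e < L ∧ T.val e ≠ 0 := by
  rcases e with l | ⟨l, z⟩
  · exact inl_mem_edges
  · exact inr_mem_edges

/-- A shift creates no edges, since flows vanish off the old ones, and the emptied edge disappears.
-/
lemma card_edges_shift_lt {U : ℕ ⊕ (Σ _ : ℕ, Y) → ℝ} (h : T.IsFlow U) (ε : ℝ)
    (hε : ∀ e ∈ T.edges, 0 ≤ T.val e + ε * U e) (h0 : ∃ e ∈ T.edges, T.val e + ε * U e = 0) :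
    (T.shift h ε hε).edges.card < T.edges.card := by
  refine Finset.card_lt_card (Finset.ssubset_iff_subset_ne.2 ⟨fun e he => ?_, fun heq => ?_⟩)
  · by_contra hne
    obtain ⟨h1, h2⟩ := mem_edges_iff.1 he
    rw [val_shift, h.zero_off e hne] at h2
    exact hne (mem_edges_iff.2 ⟨h1, by simpa using h2⟩)
  · obtain ⟨e, he, h0⟩ := h0
    rw [← heq, mem_edges_iff, val_shift] at he
    exact he.2 h0

lemma card_nontrivial_shift_le {U : ℕ ⊕ (Σ _ : ℕ, Y) → ℝ} (h : T.IsFlow U) (ε : ℝ)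
    (hε : ∀ e ∈ T.edges, 0 ≤ T.val e + ε * U e) :
    (T.shift h ε hε).nontrivial.card ≤ T.nontrivial.card := by
  refine Finset.card_le_card fun l hl => ?_
  obtain ⟨h1, h2, h3⟩ := mem_nontrivial.1 hl
  refine mem_nontrivial.2 ⟨h1, fun h0 => h2 ?_, h3⟩
  have : Sum.inl l ∉ T.edges := fun he => (inl_mem_edges.1 he).2 h0
  change T.mass l + ε * U (Sum.inl l) = 0
  rw [h.zero_off _ this, h0]; simp

/-- A network with at least as many edges as vertices carries a flow. -/
lemma exists_isFlow (T : Network Y N L A B) (hA : A ≠ 0)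
    (hcard : T.vertices.card ≤ T.edges.card) : ∃ U, T.IsFlow U ∧ U ≠ 0 := by
  classical
  obtain ⟨z₀, hz₀⟩ : ∃ z, A z ≠ 0 := by
    by_contra! hall; exact hA (Finsupp.ext hall)
  have hv₀ : ⟨0, z₀⟩ ∈ T.vertices := mem_vertices.2 ⟨Nat.zero_le _, by rwa [T.state_zero]⟩
  let coord : ℕ ⊕ (Σ _ : ℕ, Y) → (T.edges → ℝ) →ₗ[ℝ] ℝ := fun e =>
    if h : e ∈ T.edges then LinearMap.proj ⟨e, h⟩ else 0
  let outF : ℕ → Y → (T.edges → ℝ) →ₗ[ℝ] ℝ := fun l z =>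
    if l < L then coord (Sum.inr ⟨l, z⟩) + (if T.tail l = z then coord (Sum.inl l) else 0) else 0
  let inF : ℕ → Y → (T.edges → ℝ) →ₗ[ℝ] ℝ := fun l z =>
    match l with
    | 0 => 0
    | l + 1 => coord (Sum.inr ⟨l, z⟩) + (if T.head l = z then coord (Sum.inl l) else 0)
  let F : (T.edges → ℝ) →ₗ[ℝ] (T.vertices.erase ⟨0, z₀⟩ → ℝ) :=
    LinearMap.pi fun v => outF v.1.1 v.1.2 - inF v.1.1 v.1.2
  -- The unknowns are the edges, the equations the conservation laws at the vertices. The law at one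
  -- initial atom is omitted because it follows from the others, so equality of the two
  -- cardinalities already suffices.
  have hker : LinearMap.ker F ≠ ⊥ := LinearMap.ker_ne_bot_of_finrank_lt (by
    rw [Module.finrank_fintype_fun_eq_card, Module.finrank_fintype_fun_eq_card,
      Fintype.card_coe, Fintype.card_coe, Finset.card_erase_of_mem hv₀]
    have := Finset.card_pos.2 ⟨_, hv₀⟩
    omega)
  obtain ⟨W, hW, hW0⟩ := Submodule.exists_mem_ne_zero_of_ne_bot hker
  have hFW : ∀ v ∈ T.vertices.erase ⟨0, z₀⟩, outF v.1 v.2 W = inF v.1 v.2 W := fun v hv => by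
    have := congrFun (LinearMap.mem_ker.1 hW) ⟨v, hv⟩
    simpa [F, sub_eq_zero] using this
  let U : ℕ ⊕ (Σ _ : ℕ, Y) → ℝ := fun e => coord e W
  have hzero : ∀ e ∉ T.edges, U e = 0 := fun e he => by simp [U, coord, he]
  have hout : ∀ l < L, ∀ z, outF l z W = T.outflow U l z := fun l hl z => by
    simp only [outF, hl, if_true, outflow, U, LinearMap.add_apply]
    split_ifs <;> simp
  have hout' : ∀ z, outF L z W = 0 := fun z => by simp [outF]
  have hin : ∀ l z, inF (l + 1) z W = T.inflow U l z := fun l z => by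
    simp only [inF, inflow, U, LinearMap.add_apply]
    split_ifs <;> simp
  have hin0 : ∀ z, inF 0 z W = 0 := fun z => rfl
  -- Masses are nonnegative, so no edge meets a point that is not an atom of the state; conservation
  -- is automatic there.
  have hout_zero : ∀ l < L, ∀ z, T.state l z = 0 → T.outflow U l z = 0 := by
    intro l hl z hz
    have hm := T.isMoveBy l hl
    rw [hm.source, Finsupp.add_apply] at hz
    have h1 := hm.rest_nonneg z
    have h2 := single_apply_nonneg hm.mass_nonneg (T.tail l) z
    have h3 : U (Sum.inr ⟨l, z⟩) = 0 := hzero _ fun he => (inr_mem_edges.1 he).2 (by linarith)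
    unfold outflow
    rw [h3, zero_add]
    split_ifs with h
    · refine hzero _ fun he => (inl_mem_edges.1 he).2 ?_
      have h4 : Finsupp.single (T.tail l) (T.mass l) z = 0 := by linarith
      rwa [h, Finsupp.single_eq_same] at h4
    · rfl
  have hin_zero : ∀ l < L, ∀ z, T.state (l + 1) z = 0 → T.inflow U l z = 0 := by
    intro l hl z hz
    have hm := T.isMoveBy l hl
    rw [hm.target, Finsupp.add_apply] at hz
    have h1 := hm.rest_nonneg z
    have h2 := single_apply_nonneg hm.mass_nonneg (T.head l) z
    have h3 : U (Sum.inr ⟨l, z⟩) = 0 := hzero _ fun he => (inr_mem_edges.1 he).2 (by linarith)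
    unfold inflow
    rw [h3, zero_add]
    split_ifs with h
    · refine hzero _ fun he => (inl_mem_edges.1 he).2 ?_
      have h4 : Finsupp.single (T.head l) (T.mass l) z = 0 := by linarith
      rwa [h, Finsupp.single_eq_same] at h4
    · rfl
  have hstep : ∀ l, l + 1 < L → ∀ z, T.inflow U l z = T.outflow U (l + 1) z := by
    intro l hl z
    by_cases hz : T.state (l + 1) z = 0
    · rw [hin_zero l (by omega) z hz, hout_zero (l + 1) hl z hz]
    · have := hFW ⟨l + 1, z⟩ (Finset.mem_erase.2 ⟨by simp, mem_vertices.2 ⟨hl.le, hz⟩⟩)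
      rw [← hin, ← hout _ hl, this]
  have hlast : ∀ l, l + 1 = L → ∀ z, T.inflow U l z = 0 := by
    intro l hl z
    by_cases hz : T.state (l + 1) z = 0
    · exact hin_zero l (by omega) z hz
    · have := hFW ⟨l + 1, z⟩ (Finset.mem_erase.2 ⟨by simp, mem_vertices.2 ⟨hl.le, hz⟩⟩)
      rw [← hin, ← this]
      simp only [hl, hout']
  have hstart : 0 < L → ∀ z, z ≠ z₀ → T.outflow U 0 z = 0 := by
    intro hL z hne
    by_cases hz : T.state 0 z = 0
    · exact hout_zero 0 hL z hz
    · have := hFW ⟨0, z⟩ (Finset.mem_erase.2 ⟨by simpa using hne,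
        mem_vertices.2 ⟨Nat.zero_le _, hz⟩⟩)
      rw [← hout _ hL, this, hin0 z]
  -- the total flow through each level
  let tot : ℕ → ℝ := fun l => ∑ z ∈ (T.rest l).support, U (Sum.inr ⟨l, z⟩) + U (Sum.inl l)
  have hsum : ∀ l < L, ∀ S : Finset Y, (T.rest l).support ⊆ S →
      ∑ z ∈ S, U (Sum.inr ⟨l, z⟩) = ∑ z ∈ (T.rest l).support, U (Sum.inr ⟨l, z⟩) := by
    intro l _ S hS
    refine (Finset.sum_subset hS fun z _ hz => hzero _ fun he => ?_).symm
    exact hz (Finsupp.mem_support_iff.2 (inr_mem_edges.1 he).2)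
  have hsumout : ∀ l < L, ∀ S : Finset Y, (T.rest l).support ⊆ S → T.tail l ∈ S →
      ∑ z ∈ S, T.outflow U l z = tot l := by
    intro l hl S hS ht
    simp only [outflow, Finset.sum_add_distrib, hsum l hl S hS, Finset.sum_ite_eq, ht, if_true,
      tot]
  have hsumin : ∀ l < L, ∀ S : Finset Y, (T.rest l).support ⊆ S → T.head l ∈ S →
      ∑ z ∈ S, T.inflow U l z = tot l := by
    intro l hl S hS ht
    simp only [inflow, Finset.sum_add_distrib, hsum l hl S hS, Finset.sum_ite_eq, ht, if_true,
      tot]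
  -- Backwards in time: nothing flows into the final state, and conservation equates the totals of
  -- successive levels.
  have htot : ∀ n l, l + 1 + n = L → tot l = 0 := by
    intro n
    induction n with
    | zero =>
      intro l hl
      rw [← hsumin l (by omega) (insert (T.head l) (T.rest l).support) (Finset.subset_insert _ _)
        (Finset.mem_insert_self _ _)]
      exact Finset.sum_eq_zero fun z _ => hlast l hl z
    | succ n ih =>
      intro l hl
      let S := insert (T.head l) (insert (T.tail (l + 1)) ((T.rest l).support ∪
        (T.rest (l + 1)).support))
      rw [← hsumin l (by omega) S (by intro z hz; simp [S, Finsupp.mem_support_iff.1 hz])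
        (by simp [S]), Finset.sum_congr rfl fun z _ => hstep l (by omega) z,
        hsumout (l + 1) (by omega) S (by intro z hz; simp [S, Finsupp.mem_support_iff.1 hz])
        (by simp [S])]
      exact ih (l + 1) (by omega)
  have htot' : ∀ l < L, tot l = 0 := fun l hl => htot (L - (l + 1)) l (by omega)
  refine ⟨U, ⟨hzero, fun hL z => ?_, hstep, hlast, htot'⟩, fun hU => hW0 ?_⟩
  -- The omitted equation: the total outflow of level 0 vanishes, and so do all its other terms.
  · by_cases hz : z = z₀
    · subst hz
      let S := insert z (insert (T.tail 0) (T.rest 0).support)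
      have h1 := hsumout 0 hL S (by intro z hz; simp [S, Finsupp.mem_support_iff.1 hz])
        (by simp [S])
      rw [htot' 0 hL, Finset.sum_eq_single_of_mem z (by simp [S])
        (fun w _ hw => hstart hL w hw)] at h1
      exact h1
    · exact hstart hL z hz
  · funext e
    have := congrFun hU e.1
    simpa [U, coord] using this

end Flows

/-! ### Emptying edges by concavity of the cost. -/

section Reduction

variable {Y : Type*} [MetricSpace Y] {N L : ℕ} {A B : Y →₀ ℝ} {α : ℝ}

/-- A network that is not a forest can be replaced by one with fewer edges. -/
lemma exists_fewer_edges (hα : 0 ≤ α) (hα1 : α ≤ 1) (T : Network Y N L A B) (hA : A ≠ 0)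
    (hcard : T.vertices.card ≤ T.edges.card) :
    ∃ T' : Network Y N L A B, T'.cost α ≤ T.cost α ∧
      T'.nontrivial.card ≤ T.nontrivial.card ∧ T'.edges.card < T.edges.card := by
  obtain ⟨U, hU, hU0⟩ := T.exists_isFlow hA hcard
  obtain ⟨ε, hε, hε1, hε2⟩ := exists_pos_hitting (fun e he => val_pos he) (hU.exists_neg hU0)
  obtain ⟨η, hη, hη1, hη2⟩ := exists_pos_hitting (fun e he => val_pos he)
    (hU.neg.exists_neg (neg_ne_zero.2 hU0))
  -- Both shifts empty an edge; only the cost has to be compared.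
  suffices h : (T.shift hU ε hε1).cost α ≤ T.cost α ∨ (T.shift hU.neg η hη1).cost α ≤ T.cost α by
    rcases h with h | h
    · exact ⟨_, h, card_nontrivial_shift_le _ _ _, card_edges_shift_lt _ _ _ hε2⟩
    · exact ⟨_, h, card_nontrivial_shift_le _ _ _, card_edges_shift_lt _ _ _ hη2⟩
  have hsum : 0 < ε + η := add_pos hε hη
  -- With these weights the perturbations `ε * U` and `-η * U` cancel, so the masses of `T` are
  -- averages of those of the two shifts.
  have hconc : (η / (ε + η)) * (T.shift hU ε hε1).cost α +
      (ε / (ε + η)) * (T.shift hU.neg η hη1).cost α ≤ T.cost α := by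
    simp only [cost, Finset.mul_sum, ← Finset.sum_add_distrib]
    refine Finset.sum_le_sum fun l hl => ?_
    have hl := Finset.mem_range.1 hl
    have h1 := ((T.shift hU ε hε1).isMoveBy l hl).mass_nonneg
    have h2 := ((T.shift hU.neg η hη1).isMoveBy l hl).mass_nonneg
    have h3 := (wt_concave hα hα1).2 h1 h2 (div_nonneg hη.le hsum.le)
      (div_nonneg hε.le hsum.le) (by field_simp; ring)
    have h4 : (η / (ε + η)) • (T.shift hU ε hε1).mass l +
        (ε / (ε + η)) • (T.shift hU.neg η hη1).mass l = T.mass l := by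
      simp only [shift, smul_eq_mul, Pi.neg_apply]
      field_simp
      ring
    rw [h4, smul_eq_mul, smul_eq_mul] at h3
    have h5 := mul_le_mul_of_nonneg_right h3 (dist_nonneg (x := T.tail l) (y := T.head l))
    calc _ = (η / (ε + η) * wt α ((T.shift hU ε hε1).mass l) +
          ε / (ε + η) * wt α ((T.shift hU.neg η hη1).mass l)) * dist (T.tail l) (T.head l) := by
          simp only [shift]; ring
      _ ≤ _ := h5
  by_contra! hcon
  have h1 : 0 < η / (ε + η) := div_pos hη hsum
  have h2 : 0 < ε / (ε + η) := div_pos hε hsum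
  have h3 : η / (ε + η) + ε / (ε + η) = 1 := by field_simp; ring
  have h4 : T.cost α = η / (ε + η) * T.cost α + ε / (ε + η) * T.cost α := by
    rw [← add_mul, h3, one_mul]
  have h5 := mul_lt_mul_of_pos_left hcon.1 h1
  have h6 := mul_lt_mul_of_pos_left hcon.2 h2
  linarith

end Reduction

end Network

namespace Network

/-! ### Counting merging and splitting moves. -/

section Counting

variable {Y : Type*} {N L : ℕ} {A B : Y →₀ ℝ}

open Classical in
/-- The moves that arrive at an atom at rest. -/
def merging (T : Network Y N L A B) : Finset ℕ :=
  {l ∈ Finset.range L | T.mass l ≠ 0 ∧ T.rest l (T.head l) ≠ 0}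

open Classical in
/-- The moves that leave part of an atom at rest. -/
def splitting (T : Network Y N L A B) : Finset ℕ :=
  {l ∈ Finset.range L | T.mass l ≠ 0 ∧ T.rest l (T.tail l) ≠ 0}

variable {T : Network Y N L A B}

lemma mem_merging {l : ℕ} :
    l ∈ T.merging ↔ l < L ∧ T.mass l ≠ 0 ∧ T.rest l (T.head l) ≠ 0 := by
  simp [merging]

lemma mem_splitting {l : ℕ} :
    l ∈ T.splitting ↔ l < L ∧ T.mass l ≠ 0 ∧ T.rest l (T.tail l) ≠ 0 := by
  simp [splitting]

open Classical in
lemma card_support_move {s : Y →₀ ℝ} (hs : ∀ z, 0 ≤ s z) {m : ℝ} (hm : 0 ≤ m) (x : Y) :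
    (s + Finsupp.single x m).support.card + (if m ≠ 0 ∧ s x ≠ 0 then 1 else 0) =
      s.support.card + if m ≠ 0 then 1 else 0 := by
  rw [support_add_single hs hm]
  by_cases h : m = 0
  · simp [h]
  · by_cases hx : s x = 0
    · rw [if_neg h, Finset.card_insert_of_notMem (by simpa using hx)]
      simp [h, hx]
    · rw [if_neg h, Finset.insert_eq_of_mem (by simpa using hx)]
      simp [h, hx]

lemma card_edges (T : Network Y N L A B) : T.edges.card =
    ∑ l ∈ Finset.range L, ((T.rest l).support.card + if T.mass l ≠ 0 then 1 else 0) := by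
  classical
  rw [edges, Finset.card_disjSum, Finset.card_sigma, Finset.card_filter, Finset.sum_add_distrib,
    add_comm]

/-- Count edges by their end points: an atom of a later state ends one edge, or two if the move
merges there. So edges minus mergings are the vertices outside the initial state. -/
lemma card_merging_lt (hcard : T.edges.card < T.vertices.card) :
    T.merging.card < A.support.card := by
  classical
  have h : ∑ l ∈ Finset.range L, (T.state (l + 1)).support.card + T.merging.card =
      T.edges.card := by
    rw [card_edges, merging, Finset.card_filter, ← Finset.sum_add_distrib]
    refine Finset.sum_congr rfl fun l hl => ?_
    have hm := T.isMoveBy l (Finset.mem_range.1 hl)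
    rw [hm.target, card_support_move hm.rest_nonneg hm.mass_nonneg]
  rw [vertices, Finset.card_sigma, Finset.sum_range_succ', T.state_zero] at hcard
  omega

/-- The same count by starting points, which leaves out the final state. -/
lemma card_splitting_lt (hcard : T.edges.card < T.vertices.card) :
    T.splitting.card < B.support.card := by
  classical
  have h : ∑ l ∈ Finset.range L, (T.state l).support.card + T.splitting.card =
      T.edges.card := by
    rw [card_edges, splitting, Finset.card_filter, ← Finset.sum_add_distrib]
    refine Finset.sum_congr rfl fun l hl => ?_
    have hm := T.isMoveBy l (Finset.mem_range.1 hl)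
    rw [hm.source, card_support_move hm.rest_nonneg hm.mass_nonneg]
  rw [vertices, Finset.card_sigma, Finset.sum_range_succ, T.state_last] at hcard
  omega

lemma state_apply_eq_of_untouched {y : Y} {i j : ℕ} (hij : i ≤ j) (hj : j ≤ L)
    (h : ∀ l, i ≤ l → l < j → l ∈ T.nontrivial → T.tail l ≠ y ∧ T.head l ≠ y) :
    T.state j y = T.state i y := by
  induction j, hij using Nat.le_induction with
  | base => rfl
  | succ j hij ih =>
    rw [← ih (by omega) fun l h1 h2 => h l h1 (by omega)]
    have hm := T.isMoveBy j (by omega)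
    rw [hm.target, hm.source, Finsupp.add_apply, Finsupp.add_apply]
    by_cases hn : j ∈ T.nontrivial
    · obtain ⟨h1, h2⟩ := h j hij (by omega) hn
      rw [Finsupp.single_eq_of_ne h1.symm, Finsupp.single_eq_of_ne h2.symm]
    · rw [mem_nontrivial] at hn
      by_cases hm0 : T.mass j = 0
      · simp [hm0]
      · have : T.tail j = T.head j := by
          by_contra hne
          exact hn ⟨by omega, hm0, hne⟩
        rw [this]

end Counting

/-! ### Leaving out stops, and the bound on the number of moves. -/

section Merge

variable {Y : Type*} [MetricSpace Y] {N L : ℕ} {A B : Y →₀ ℝ} {α : ℝ}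

/-- If an atom comes to rest at a vacant place and then moves on as a whole, the stop can be
left out. -/
lemma exists_fewer_nontrivial (T : Network Y N L A B) {i j : ℕ} (hij : i < j)
    (hi : i ∈ T.nontrivial) (hj : j ∈ T.nontrivial) (hiy : T.rest i (T.head i) = 0)
    (htail : T.tail j = T.head i) (hjy : T.rest j (T.head i) = 0)
    (h : ∀ l, i < l → l < j → l ∈ T.nontrivial → T.tail l ≠ T.head i ∧ T.head l ≠ T.head i) :
    ∃ T' : Network Y N L A B, T'.cost α ≤ T.cost α ∧
      T'.nontrivial.card < T.nontrivial.card := by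
  classical
  obtain ⟨hiL, hmi, hxi⟩ := mem_nontrivial.1 hi
  obtain ⟨hjL, hmj, hxj⟩ := mem_nontrivial.1 hj
  have hmvi := T.isMoveBy i hiL
  have hmvj := T.isMoveBy j hjL
  set y := T.head i with hy
  set z := T.head j with hz
  have hyz : z ≠ y := by rw [← htail]; exact hxj.symm
  -- The atom that arrives at `y` is alone there and untouched until the `j`-th move takes all of
  -- it.
  have hmass : T.mass j = T.mass i := by
    have h1 : T.state j y = T.mass j := by
      rw [hmvj.source, Finsupp.add_apply, hjy, htail, Finsupp.single_eq_same, zero_add]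
    have h2 : T.state (i + 1) y = T.mass i := by
      rw [hmvi.target, Finsupp.add_apply, hiy, Finsupp.single_eq_same, zero_add]
    rw [← h1, ← h2]
    exact state_apply_eq_of_untouched hij hjL.le fun l h1 h2 => h l (by omega) h2
  -- Between the two moves the atom waits at `z` instead of `y`: the `i`-th move goes straight to
  -- `z` and the `j`-th becomes trivial. Pushing forward by `ρ` never increases the number of atoms.
  let ρ : Y → Y := fun w => if w = y then z else w
  have hρy : ρ y = z := by simp [ρ]
  have hρ : ∀ w, w ≠ y → ρ w = w := fun w hw => by simp [ρ, hw]
  have hmap : ∀ s : Y →₀ ℝ, s y = 0 → s.mapDomain ρ = s := by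
    intro s hs
    conv_rhs => rw [← Finsupp.mapDomain_id (v := s)]
    refine Finsupp.mapDomain_congr fun w hw => hρ w ?_
    rintro rfl
    exact Finsupp.mem_support_iff.1 hw hs
  have hmap0 : ∀ s : Y →₀ ℝ, (∀ w, 0 ≤ s w) → ∀ w, 0 ≤ s.mapDomain ρ w := by
    intro s hs w
    rw [Finsupp.mapDomain, Finsupp.sum, Finsupp.finsetSum_apply]
    exact Finset.sum_nonneg fun v _ => single_apply_nonneg (hs v) _ _
  have hmapcard : ∀ s : Y →₀ ℝ, (s.mapDomain ρ).support.card ≤ s.support.card := fun s =>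
    (Finset.card_le_card Finsupp.mapDomain_support).trans Finset.card_image_le
  let T' : Network Y N L A B :=
    { state := fun l => if i < l ∧ l ≤ j then (T.state l).mapDomain ρ else T.state l
      rest := fun l => if i < l ∧ l < j then (T.rest l).mapDomain ρ else T.rest l
      mass := T.mass
      tail := fun l => if i < l ∧ l ≤ j then ρ (T.tail l) else T.tail l
      head := fun l => if i ≤ l ∧ l < j then ρ (T.head l) else T.head l
      isMoveBy := by
        intro l hl
        have hm := T.isMoveBy l hl
        rcases lt_trichotomy l i with h1 | rfl | h1
        · have e1 : ¬ i < l := by omega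
          have e2 : ¬ i ≤ l := by omega
          have e3 : ¬ i < l + 1 := by omega
          simpa [e1, e2, e3] using hm
        · have e3 : l + 1 ≤ j := hij
          simp only [lt_irrefl, false_and, if_false, le_refl, hij, true_and, if_true,
            Nat.lt_succ_self, e3]
          refine ⟨hm.rest_nonneg, hm.mass_nonneg, hm.card_lt, hm.source, ?_⟩
          rw [hm.target, Finsupp.mapDomain_add, hmap _ hiy, Finsupp.mapDomain_single]
        · rcases lt_trichotomy l j with h2 | rfl | h2
          · have e1 : i < l + 1 := by omega
            have e2 : l + 1 ≤ j := h2
            simp only [h1, h2, h1.le, h2.le, e1, e2, and_self, if_true]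
            refine ⟨hmap0 _ hm.rest_nonneg, hm.mass_nonneg,
              (hmapcard _).trans_lt hm.card_lt, ?_, ?_⟩
            · rw [hm.source, Finsupp.mapDomain_add, Finsupp.mapDomain_single]
            · rw [hm.target, Finsupp.mapDomain_add, Finsupp.mapDomain_single]
          · have e1 : ¬ l + 1 ≤ l := by omega
            simp only [h1, le_refl, and_self, if_true, lt_irrefl, and_false, if_false, e1]
            refine ⟨hm.rest_nonneg, hm.mass_nonneg, hm.card_lt, ?_, hm.target⟩
            rw [hm.source, Finsupp.mapDomain_add, hmap _ hjy, Finsupp.mapDomain_single]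
          · have e1 : ¬ l ≤ j := by omega
            have e2 : ¬ l < j := by omega
            have e3 : ¬ l + 1 ≤ j := by omega
            simpa [e1, e2, e3] using hm
      state_zero := by simp [T.state_zero]
      state_last := by
        have e1 : ¬ L ≤ j := by omega
        simp [e1, T.state_last] }
  have hmass' : ∀ l, T'.mass l = T.mass l := fun l => rfl
  have htail' : ∀ l, T'.tail l = if i < l ∧ l ≤ j then ρ (T.tail l) else T.tail l := fun l => rfl
  have hhead' : ∀ l, T'.head l = if i ≤ l ∧ l < j then ρ (T.head l) else T.head l := fun l => rfl
  have hti : T'.tail i = T.tail i := by rw [htail']; simp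
  have hhi : T'.head i = z := by rw [hhead', if_pos ⟨le_rfl, hij⟩, ← hy, hρy]
  have htj : T'.tail j = z := by rw [htail', if_pos ⟨hij, le_rfl⟩, htail, hρy]
  have hhj : T'.head j = z := by rw [hhead']; simp [hz]
  have hother : ∀ l ∈ Finset.range L, l ≠ i → l ≠ j →
      wt α (T'.mass l) * dist (T'.tail l) (T'.head l) =
        wt α (T.mass l) * dist (T.tail l) (T.head l) := by
    intro l hl hli hlj
    rw [hmass', htail', hhead']
    by_cases hb : i < l ∧ l < j
    · rw [if_pos ⟨hb.1, hb.2.le⟩, if_pos ⟨hb.1.le, hb.2⟩]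
      by_cases hn : l ∈ T.nontrivial
      · obtain ⟨h1, h2⟩ := h l hb.1 hb.2 hn
        rw [hρ _ h1, hρ _ h2]
      · rw [mem_nontrivial] at hn
        by_cases hm0 : T.mass l = 0
        · simp [hm0]
        · have : T.tail l = T.head l := by
            by_contra hne
            exact hn ⟨Finset.mem_range.1 hl, hm0, hne⟩
          rw [this]; simp
    · rw [if_neg (by omega), if_neg (by omega)]
  refine ⟨T', ?_, Finset.card_lt_card (Finset.ssubset_iff_subset_ne.2
    ⟨fun l hl => ?_, fun heq => ?_⟩)⟩
  · have hiR : i ∈ Finset.range L := Finset.mem_range.2 hiL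
    have hjR : j ∈ (Finset.range L).erase i :=
      Finset.mem_erase.2 ⟨hij.ne', Finset.mem_range.2 hjL⟩
    rw [cost, cost, ← Finset.add_sum_erase _ _ hiR, ← Finset.add_sum_erase _ _ hjR,
      ← Finset.add_sum_erase (Finset.range L) _ hiR, ← Finset.add_sum_erase _ _ hjR,
      ← add_assoc, ← add_assoc]
    refine add_le_add ?_ (Finset.sum_le_sum fun l hl => ?_)
    · rw [hti, hhi, htj, hhj, dist_self, mul_zero, add_zero, hmass', hmass, ← mul_add, htail]
      exact mul_le_mul_of_nonneg_left (dist_triangle _ _ _) (wt_nonneg hmvi.mass_nonneg)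
    · rw [Finset.mem_erase, Finset.mem_erase] at hl
      exact (hother l hl.2.2 hl.2.1 hl.1).le
  · obtain ⟨h1, h2, h3⟩ := mem_nontrivial.1 hl
    refine mem_nontrivial.2 ⟨h1, h2, fun h4 => h3 ?_⟩
    by_cases hli : l = i
    · subst hli; exact absurd h4 hxi
    by_cases hlj : l = j
    · subst hlj; exact absurd h4 hxj
    rw [htail', hhead', h4]
    by_cases hb : i < l ∧ l < j
    · rw [if_pos ⟨hb.1, hb.2.le⟩, if_pos ⟨hb.1.le, hb.2⟩]
    · rw [if_neg (by omega), if_neg (by omega)]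
  · rw [← heq] at hj
    exact (mem_nontrivial.1 hj).2.2 (htj.trans hhj.symm)

/-- The bound on the number of moves in a network that has as few of them as possible. -/
lemma card_nontrivial_le {T : Network Y N L A B}
    (hmin : ∀ T' : Network Y N L A B, T'.cost α ≤ T.cost α →
      T.nontrivial.card ≤ T'.nontrivial.card) :
    T.nontrivial.card ≤ 2 * T.merging.card + T.splitting.card + B.support.card := by
  classical
  let next : ℕ → ℕ → Prop := fun i j => i < j ∧ j ∈ T.nontrivial ∧
    (T.tail j = T.head i ∨ T.head j = T.head i) ∧
    ∀ l, i < l → l < j → l ∈ T.nontrivial → T.tail l ≠ T.head i ∧ T.head l ≠ T.head i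
  -- A move in `S` brings its mass to a vacant place. It is charged to the next move touching that
  -- place, as a merging or a splitting, or to the final atom there if there is no such move. The
  -- sum is disjoint because one move may both merge and split.
  let S := T.nontrivial \ T.merging
  let D : Finset ((ℕ ⊕ ℕ) ⊕ Y) := (T.merging.disjSum T.splitting).disjSum B.support
  let r : ℕ → (ℕ ⊕ ℕ) ⊕ Y → Prop := fun i => Sum.elim
    (Sum.elim (fun j => next i j ∧ T.head j = T.head i)
      (fun j => next i j ∧ T.tail j = T.head i))
    (fun y => T.head i = y ∧ ∀ l, i < l → l ∈ T.nontrivial →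
      T.tail l ≠ T.head i ∧ T.head l ≠ T.head i)
  have hSD : S.card ≤ D.card := by
    refine Finset.card_le_card_of_forall_subsingleton r (fun i hi => ?_) (fun d hd => ?_)
    · obtain ⟨hi1, hi2⟩ := Finset.mem_sdiff.1 hi
      obtain ⟨hiL, hmi, hxi⟩ := mem_nontrivial.1 hi1
      have hmvi := T.isMoveBy i hiL
      have hiy : T.rest i (T.head i) = 0 := by
        by_contra h0; exact hi2 (mem_merging.2 ⟨hiL, hmi, h0⟩)
      have hst : T.state (i + 1) (T.head i) = T.mass i := by
        rw [hmvi.target, Finsupp.add_apply, hiy, Finsupp.single_eq_same, zero_add]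
      by_cases hex : ∃ j, i < j ∧ j ∈ T.nontrivial ∧
          (T.tail j = T.head i ∨ T.head j = T.head i)
      · have hnext : next i (Nat.find hex) := by
          obtain ⟨h1, h2, h3⟩ := Nat.find_spec hex
          refine ⟨h1, h2, h3, fun l hl1 hl2 hl3 => ?_⟩
          have := Nat.find_min hex hl2
          tauto
        obtain ⟨hij, hj, hor, hbetween⟩ := id hnext
        set j := Nat.find hex
        obtain ⟨hjL, hmj, hxj⟩ := mem_nontrivial.1 hj
        have hmvj := T.isMoveBy j hjL
        have hstj : T.state j (T.head i) = T.mass i := by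
          rw [← hst]
          exact state_apply_eq_of_untouched hij hjL.le fun l h1 h2 => hbetween l (by omega) h2
        by_cases hhead : T.head j = T.head i
        · refine ⟨Sum.inl (Sum.inl j), ?_, hnext, hhead⟩
          refine Finset.inl_mem_disjSum.2 (Finset.inl_mem_disjSum.2
            (mem_merging.2 ⟨hjL, hmj, ?_⟩))
          rw [hmvj.source, Finsupp.add_apply, ← hhead, Finsupp.single_eq_of_ne hxj.symm,
            add_zero] at hstj
          rwa [hstj]
        · have htail : T.tail j = T.head i := by tauto
          -- If the `j`-th move took the whole atom, the stop could be left out, contradicting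
          -- minimality.
          refine ⟨Sum.inl (Sum.inr j), ?_, hnext, htail⟩
          refine Finset.inl_mem_disjSum.2 (Finset.inr_mem_disjSum.2
            (mem_splitting.2 ⟨hjL, hmj, fun h0 => ?_⟩))
          rw [htail] at h0
          obtain ⟨T', hT'1, hT'2⟩ := T.exists_fewer_nontrivial (α := α) hij hi1 hj hiy htail h0
            hbetween
          exact absurd (hmin T' hT'1) (not_le.2 hT'2)
      · have hun : ∀ l, i < l → l ∈ T.nontrivial →
            T.tail l ≠ T.head i ∧ T.head l ≠ T.head i := by
          intro l h1 h2
          by_contra hcon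
          exact hex ⟨l, h1, h2, by tauto⟩
        refine ⟨Sum.inr (T.head i), ?_, rfl, hun⟩
        refine Finset.inr_mem_disjSum.2 (Finsupp.mem_support_iff.2 ?_)
        have := state_apply_eq_of_untouched (T := T) (y := T.head i) (i := i + 1) (j := L) hiL
          le_rfl fun l h1 _ => hun l (by omega)
        rw [T.state_last] at this
        rwa [this, hst]
    -- Two moves with the same charge arrive at the same place, so the later one touches it at a
    -- time when it should be left alone after the earlier one.
    · have aux : ∀ i ∈ S, ∀ i' ∈ S, i < i' → r i d → r i' d → False := by
        intro i hi i' hi' hlt hr hr'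
        have hi'n := (Finset.mem_sdiff.1 hi').1
        rcases d with (j | j) | y
        · have hh : T.head i' = T.head i := hr'.2.symm.trans hr.2
          exact (hr.1.2.2.2 i' hlt hr'.1.1 hi'n).2 hh
        · have hh : T.head i' = T.head i := hr'.2.symm.trans hr.2
          exact (hr.1.2.2.2 i' hlt hr'.1.1 hi'n).2 hh
        · have hh : T.head i' = T.head i := hr'.1.trans hr.1.symm
          exact (hr.2 i' hlt hi'n).2 hh
      intro i hi i' hi'
      by_contra hne
      rcases lt_or_gt_of_ne hne with hlt | hlt
      · exact aux i hi.1 i' hi'.1 hlt hi.2 hi'.2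
      · exact aux i' hi'.1 i hi.1 hlt hi'.2 hi.2
  rw [Finset.card_disjSum, Finset.card_disjSum] at hSD
  have h1 : T.nontrivial.card ≤ S.card + T.merging.card :=
    Finset.card_le_card_sdiff_add_card
  omega

/-- Every network can be replaced by a reduced one that is not more expensive. -/
lemma exists_reduced (hα : 0 ≤ α) (hα1 : α ≤ 1) (T : Network Y N L A B) (hA : A ≠ 0) :
    ∃ T' : Network Y N L A B, T'.cost α ≤ T.cost α ∧ T'.edges.card < T'.vertices.card ∧
      ∀ T'' : Network Y N L A B, T''.cost α ≤ T'.cost α →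
        T'.nontrivial.card ≤ T''.nontrivial.card := by
  let P : Set (Network Y N L A B) := {T' | T'.cost α ≤ T.cost α}
  -- Emptying an edge does not add nontrivial moves, so a lexicographic minimum has both properties
  -- at once.
  let f : Network Y N L A B → ℕ ×ₗ ℕ := fun T' => toLex (T'.nontrivial.card, T'.edges.card)
  obtain ⟨T', hT', hmin⟩ := (InvImage.wf f wellFounded_lt).has_min P ⟨T, le_refl (T.cost α)⟩
  refine ⟨T', hT', ?_, fun T'' hT'' => ?_⟩
  · by_contra! hcon
    obtain ⟨T'', h1, h2, h3⟩ := exists_fewer_edges hα hα1 T' hA hcon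
    refine hmin T'' (h1.trans hT') ?_
    rcases h2.lt_or_eq with h2 | h2
    · exact Prod.Lex.toLex_lt_toLex.2 (Or.inl h2)
    · exact Prod.Lex.toLex_lt_toLex.2 (Or.inr ⟨h2, h3⟩)
  · by_contra! hcon
    exact hmin T'' (hT''.trans hT') (Prod.Lex.toLex_lt_toLex.2 (Or.inl hcon))

end Merge

end Network

/-- A chain between measures with at most `N` atoms can be shortened to `4 * N - 3` moves. -/
lemma Chain.exists_short {Y : Type*} [MetricSpace Y] {N k : ℕ} {α c : ℝ} {A B : Y →₀ ℝ}
    (hα : 0 ≤ α) (hα1 : α ≤ 1)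
    (h : Chain N α k A B c) (hA0 : A ≠ 0) (hA : A.support.card ≤ N) (hB : B.support.card ≤ N) :
    ∃ l ≤ 4 * N - 3, ∃ c' ≤ c, Chain N α l A B c' := by
  obtain ⟨z, -⟩ := Finsupp.support_nonempty_iff.2 hA0
  have : Nonempty Y := ⟨z⟩
  obtain ⟨T, rfl⟩ := h.exists_network
  obtain ⟨T', hcost, hcard, hmin⟩ := T.exists_reduced hα hα1 hA0
  refine ⟨_, ?_, _, hcost, T'.chain⟩
  have h1 := Network.card_merging_lt hcard
  have h2 := Network.card_splitting_lt hcard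
  have h3 := Network.card_nontrivial_le hmin
  -- 2(N-1) + (N-1) + N = 4N-3.
  omega

/-! ### The chain distance -/

section ChainDist

variable {Y : Type*} [MetricSpace Y] {N : ℕ} {α : ℝ}

lemma sum_single_self {Y : Type*} (a : Y →₀ ℝ) : ∑ z ∈ a.support, Finsupp.single z (a z) = a :=
  Finsupp.sum_single a

/-- The easy half of Kantorovich duality: a move changes the integral of `φ` by at most m d(x,y),
which is at most m^α d(x,y) since m ≤ 1. The total mass is carried along to ensure this bound on m.
-/
lemma Chain.abs_pairing_sub_le (hα1 : α ≤ 1) {k : ℕ} {a b : Y →₀ ℝ} {c : ℝ}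
    (h : Chain N α k a b c) (ha : ∀ z, 0 ≤ a z) (ha1 : (a.sum fun _ m => m) = 1) :
    (∀ z, 0 ≤ b z) ∧ (b.sum fun _ m => m) = 1 ∧
      ∀ φ : Y → ℝ, (∀ x y, |φ x - φ y| ≤ dist x y) → |pairing φ a - pairing φ b| ≤ c := by
  induction h with
  | nil a => exact ⟨ha, ha1, by simp⟩
  | @snoc k a b b' s m c x y _ hm ih =>
    obtain ⟨hb, hb1, hφ⟩ := ih ha ha1
    have hb' : (b'.sum fun _ m => m) = 1 := by
      rw [← hb1, ← pairing_one, ← pairing_one, hm.source, hm.target, pairing_add, pairing_add,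
        pairing_single, pairing_single]
    refine ⟨hm.nonneg_target, hb', fun φ hL => ?_⟩
    have hm1 : m ≤ 1 := by
      refine le_trans ?_ (apply_le_total hm.nonneg_target hb' y)
      rw [hm.target, Finsupp.add_apply, Finsupp.single_eq_same]
      linarith [hm.rest_nonneg y]
    have h1 : |pairing φ b - pairing φ b'| ≤ wt α m * dist x y := by
      rw [hm.source, hm.target, pairing_add, pairing_add, pairing_single, pairing_single,
        add_sub_add_left_eq_sub, ← mul_sub, abs_mul, abs_of_nonneg hm.mass_nonneg]
      exact mul_le_mul (le_wt hα1 hm.mass_nonneg hm1) (hL x y) (abs_nonneg _)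
        (wt_nonneg hm.mass_nonneg)
    exact (abs_sub_le _ (pairing φ b) _).trans (add_le_add (hφ φ hL) h1)

/-- The distance induced by chains of moves within the measures with at most `N` atoms. -/
def chainDist (α : ℝ) (a b : AtomicProb N Y) : ℝ :=
  sInf {c | ∃ k, Chain N α k a.1 b.1 c}

lemma chainDist_le {a b : AtomicProb N Y} {k : ℕ} {c : ℝ} (h : Chain N α k a.1 b.1 c) :
    chainDist α a b ≤ c :=
  csInf_le ⟨0, by rintro c ⟨k, h⟩; exact h.cost_nonneg⟩ ⟨k, h⟩

/-- An assignment `i` of the atoms of `b` to places of departure gives a chain of moves. -/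
lemma chain_star {b : Y →₀ ℝ} (hb : ∀ y, 0 ≤ b y) (hbN : b.support.card ≤ N) (i : Y → Y) :
    Chain N α b.support.card (∑ y ∈ b.support, Finsupp.single (i y) (b y)) b
      (∑ y ∈ b.support, wt α (b y) * dist (i y) y) := by
  classical
  have := chain_of_family (N := N) (α := α) b.support (fun y => b y) i id (fun y _ => hb y)
    fun y hy r _ => lt_of_le_of_lt (card_support_sum_single_le _ _ _) (by
      rw [Finset.card_erase_of_mem hy]
      have := Finset.card_pos.2 ⟨y, hy⟩
      omega)
  simpa only [id, sum_single_self] using this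

/-- Both measures can be gathered at one point. So the infimum in `chainDist` is over a nonempty
set. -/
lemma exists_chain (a b : AtomicProb N Y) : ∃ k c, Chain N α k a.1 b.1 c := by
  have hsum : ∀ (u : Y) (a : AtomicProb N Y),
      ∑ y ∈ a.1.support, Finsupp.single u (a.1 y) = Finsupp.single u 1 := by
    intro u a
    rw [← Finsupp.single_finsetSum]
    exact congrArg _ a.2.2.1
  obtain ⟨u, -⟩ : a.1.support.Nonempty := by
    refine Finsupp.support_nonempty_iff.2 fun h => ?_
    have := a.2.2.1
    simp [h] at this
  have h1 := chain_star (α := α) a.2.1 a.2.2.2 fun _ => u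
  have h2 := chain_star (α := α) b.2.1 b.2.2.2 fun _ => u
  rw [hsum] at h1 h2
  exact ⟨_, _, h1.symm.trans h2⟩

lemma exists_chain_lt {a b : AtomicProb N Y} {r : ℝ} (h : chainDist α a b < r) :
    ∃ k c, c < r ∧ Chain N α k a.1 b.1 c := by
  obtain ⟨k, c, hc⟩ := exists_chain (α := α) a b
  obtain ⟨c, ⟨k, hk⟩, hlt⟩ := exists_lt_of_csInf_lt (s := {c | ∃ k, Chain N α k a.1 b.1 c}) ⟨c, k, hc⟩ h
  exact ⟨k, c, hlt, hk⟩

lemma le_chainDist {a b : AtomicProb N Y} {r : ℝ} (h : ∀ k c, Chain N α k a.1 b.1 c → r ≤ c) :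
    r ≤ chainDist α a b := by
  by_contra! hlt
  obtain ⟨k, c, hc, hk⟩ := exists_chain_lt hlt
  exact absurd (h k c hk) (not_le.2 hc)

lemma chainDist_nonneg (a b : AtomicProb N Y) : 0 ≤ chainDist α a b :=
  le_chainDist fun _ _ h => h.cost_nonneg

lemma chainDist_self (a : AtomicProb N Y) : chainDist α a a = 0 :=
  le_antisymm (chainDist_le (.nil a.1)) (chainDist_nonneg a a)

lemma chainDist_symm (a b : AtomicProb N Y) : chainDist α a b = chainDist α b a :=
  le_antisymm (le_chainDist fun _ _ h => chainDist_le h.symm)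
    (le_chainDist fun _ _ h => chainDist_le h.symm)

lemma chainDist_triangle (a b c : AtomicProb N Y) :
    chainDist α a b ≤ chainDist α a c + chainDist α c b := by
  refine le_of_forall_pos_le_add fun ε hε => ?_
  obtain ⟨k, r, hr, hk⟩ := exists_chain_lt (lt_add_of_pos_right (chainDist α a c) (half_pos hε))
  obtain ⟨l, s, hs, hl⟩ := exists_chain_lt (lt_add_of_pos_right (chainDist α c b) (half_pos hε))
  linarith [chainDist_le (hk.trans hl)]

lemma eq_of_chainDist_eq_zero (hα1 : α ≤ 1) {a b : AtomicProb N Y} (h : chainDist α a b = 0) :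
    a = b := by
  classical
  by_contra hab
  obtain ⟨z, hz⟩ : ∃ z, a.1 z ≠ b.1 z := by
    by_contra! hall
    exact hab (Subtype.ext (Finsupp.ext hall))
  obtain ⟨δ, hδ, hsep⟩ := exists_pos_separation (insert z (a.1.support ∪ b.1.support))
  -- A 1-Lipschitz tent that sees no atom other than `z`.
  let φ : Y → ℝ := fun w => max 0 (δ - dist w z)
  have hφ : ∀ x y, |φ x - φ y| ≤ dist x y := fun x y => by
    have h1 := abs_max_sub_max_le_abs (δ - dist x z) (δ - dist y z) 0
    rw [sub_sub_sub_cancel_left, max_comm, max_comm (δ - dist y z)] at h1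
    refine h1.trans ?_
    rw [dist_comm x y]
    exact abs_dist_sub_le _ _ _
  have hval : ∀ c : Y →₀ ℝ, c.support ⊆ a.1.support ∪ b.1.support → pairing φ c = c z * δ := by
    intro c hc
    rw [pairing_eq_sum φ (hc.trans (Finset.subset_insert z _)),
      Finset.sum_eq_single_of_mem z (Finset.mem_insert_self _ _)]
    · simp [φ, hδ.le]
    · intro w hw hwz
      have : δ - dist w z ≤ 0 := by linarith [hsep w hw z (Finset.mem_insert_self _ _) hwz]
      simp [φ, this]
  have hle : |pairing φ a.1 - pairing φ b.1| ≤ chainDist α a b :=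
    le_chainDist fun k c hc => (hc.abs_pairing_sub_le hα1 a.2.1 a.2.2.1).2.2 φ hφ
  rw [h, hval _ Finset.subset_union_left, hval _ Finset.subset_union_right, ← sub_mul, abs_mul]
    at hle
  have := mul_pos (abs_pos.2 (sub_ne_zero.2 hz)) (abs_pos.2 hδ.ne')
  linarith

end ChainDist

/-! ### Comparison of the chain distance with `J_α` -/

section Comparison

variable {Y : Type*} [MetricSpace Y] {N : ℕ} {α : ℝ}

/-- If `a` has a spare atom, then a plan from `a` to `b` can be realized by exchanging mass among
the atoms of `a` before moving to the atoms of `b`. -/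
lemma chain_transfer_star {a b : Y →₀ ℝ} (haN : a.support.card < N)
    (hb : ∀ y, 0 ≤ b y) (hbN : b.support.card ≤ N) {γ : Y × Y →₀ ℝ} (hγ : γ ∈ Plan a b) {i : Y → Y}
    (hi : ∀ y ∈ b.support, i y ∈ a.support) :
    ∃ k, Chain N α k a b (∑ x ∈ a.support, ∑ y ∈ b.support, wt α (γ (x, y)) * dist x (i y) +
      ∑ y ∈ b.support, wt α (b y) * dist (i y) y) := by
  classical
  have h1 := chain_of_family (N := N) (α := α) (a.support ×ˢ b.support) (fun p => γ p)
    (fun p => p.1) (fun p => i p.2) (fun p _ => hγ.1 p) (by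
      intro p hp r hr
      refine lt_of_le_of_lt (Finset.card_le_card ?_) haN
      refine Finsupp.support_finsetSum.trans (Finset.biUnion_subset.2 fun q hq => ?_)
      have hq' := Finset.mem_of_mem_erase hq
      have hqm := Finset.mem_product.1 hq'
      refine Finsupp.support_single_subset.trans (Finset.singleton_subset_iff.2 ?_)
      rcases hr q hq' with h | h <;> rw [h]
      exacts [hqm.1, hi _ hqm.2])
  have h2 : ∑ p ∈ a.support ×ˢ b.support, Finsupp.single p.1 (γ p) = a := by
    rw [Finset.sum_product]
    conv_rhs => rw [← sum_single_self a]
    refine Finset.sum_congr rfl fun x hx => ?_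
    simp only
    rw [← Finsupp.single_finsetSum, Plan.sum_right hγ hx]
  have h3 : ∑ p ∈ a.support ×ˢ b.support, Finsupp.single (i p.2) (γ p) =
      ∑ y ∈ b.support, Finsupp.single (i y) (b y) := by
    rw [Finset.sum_product_right]
    refine Finset.sum_congr rfl fun y hy => ?_
    simp only
    rw [← Finsupp.single_finsetSum, Plan.sum_left hγ hy]
  rw [h2, h3, Finset.sum_product] at h1
  exact ⟨_, h1.trans (chain_star hb hbN i)⟩

lemma exists_nearest {a : Y →₀ ℝ} (ha : a ≠ 0) :
    ∃ i : Y → Y, ∀ y, i y ∈ a.support ∧ ∀ x ∈ a.support, dist (i y) y ≤ dist x y := by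
  have h : ∀ y, ∃ x ∈ a.support, ∀ x' ∈ a.support, dist x y ≤ dist x' y := fun y =>
    a.support.exists_min_image (fun x => dist x y) (Finsupp.support_nonempty_iff.2 ha)
  choose i hi1 hi2 using h
  exact ⟨i, fun y => ⟨hi1 y, hi2 y⟩⟩

lemma AtomicProb.ne_zero {Y : Type*} (a : AtomicProb N Y) : a.1 ≠ 0 := fun h => by
  have := a.2.2.1
  simp [h] at this

lemma wt_mul_le_sum {Y : Type*} (hα : 0 ≤ α) (hα1 : α ≤ 1) {a b : Y →₀ ℝ} {γ : Y × Y →₀ ℝ}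
    (hγ : γ ∈ Plan a b) {y : Y} (hy : y ∈ b.support) {d : ℝ} (hd : 0 ≤ d) :
    wt α (b y) * d ≤ ∑ x ∈ a.support, wt α (γ (x, y)) * d := by
  rw [← Finset.sum_mul, ← Plan.sum_left hγ hy]
  exact mul_le_mul_of_nonneg_right (wt_sum_le hα hα1 _ _ fun _ _ => hγ.1 _) hd

/-- The mass `γ (x, y)` travels from `x` by way of `i y` to `y`. The second legs to the same `y` are
made together, which by subadditivity costs no more than making them separately. -/
lemma chainDist_le_mul_planCost (hα : 0 ≤ α) (hα1 : α ≤ 1) {a b : AtomicProb N Y}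
    (haN : a.1.support.card < N) {γ : Y × Y →₀ ℝ} (hγ : γ ∈ Plan a.1 b.1) {i : Y → Y}
    (hi : ∀ y ∈ b.1.support, i y ∈ a.1.support) {K : ℝ}
    (hK : ∀ x ∈ a.1.support, ∀ y ∈ b.1.support,
      dist x (i y) + dist (i y) y ≤ K * dist x y) :
    chainDist α a b ≤ K * planCost α γ := by
  obtain ⟨k, hk⟩ := chain_transfer_star (α := α) haN b.2.1 b.2.2.2 hγ hi
  refine (chainDist_le hk).trans ?_
  have h1 : ∑ y ∈ b.1.support, wt α (b.1 y) * dist (i y) y ≤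
      ∑ x ∈ a.1.support, ∑ y ∈ b.1.support, wt α (γ (x, y)) * dist (i y) y := by
    rw [Finset.sum_comm]
    exact Finset.sum_le_sum fun y hy => wt_mul_le_sum hα hα1 hγ hy dist_nonneg
  refine (add_le_add_right h1 _).trans ?_
  rw [Plan.cost_eq hγ, Finset.mul_sum, ← Finset.sum_add_distrib]
  refine Finset.sum_le_sum fun x hx => ?_
  rw [Finset.mul_sum, ← Finset.sum_add_distrib]
  refine Finset.sum_le_sum fun y hy => ?_
  rw [← mul_add, mul_left_comm]
  exact mul_le_mul_of_nonneg_left (hK x hx y hy) (wt_nonneg (hγ.1 _))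

lemma chainDist_le_mul (hα : 0 ≤ α) (hα1 : α ≤ 1) {a b : AtomicProb N Y}
    (haN : a.1.support.card < N) {i : Y → Y}
    (hi : ∀ y ∈ b.1.support, i y ∈ a.1.support) {K : ℝ} (hK0 : 0 < K)
    (hK : ∀ x ∈ a.1.support, ∀ y ∈ b.1.support,
      dist x (i y) + dist (i y) y ≤ K * dist x y) :
    chainDist α a b ≤ K * transportQuasimetric α a b := by
  rw [← div_le_iff₀' hK0]
  refine le_transportQuasimetric fun γ hγ => ?_
  rw [div_le_iff₀' hK0]
  exact chainDist_le_mul_planCost hα hα1 haN hγ hi hK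

/-- A detour through the atom nearest to `y` has length at most 2 d(x,y) + d(x,y). -/
lemma chainDist_le_three_mul (hα : 0 ≤ α) (hα1 : α ≤ 1) {a b : AtomicProb N Y}
    (haN : a.1.support.card < N) :
    chainDist α a b ≤ 3 * transportQuasimetric α a b := by
  obtain ⟨i, hi⟩ := exists_nearest a.ne_zero
  refine chainDist_le_mul hα hα1 haN (fun y _ => (hi y).1) three_pos fun x hx y _ => ?_
  have h1 := (hi y).2 x hx
  have h2 := dist_triangle x y (i y)
  rw [dist_comm y] at h2
  linarith

/-- There is no detour if `x = i y`. Otherwise d(x,y) ≥ δ - r, and the detour adds at most 2r. -/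
lemma chainDist_le_one_add_mul (hα : 0 ≤ α) (hα1 : α ≤ 1) {a b : AtomicProb N Y}
    (haN : a.1.support.card < N) {δ r η : ℝ} (hη : 0 ≤ η) (hrη : 2 * r ≤ η * (δ - r))
    (hsep : ∀ p ∈ a.1.support, ∀ q ∈ a.1.support, p ≠ q → δ ≤ dist p q) {i : Y → Y}
    (hi : ∀ y ∈ b.1.support, i y ∈ a.1.support ∧ dist (i y) y ≤ r) :
    chainDist α a b ≤ (1 + η) * transportQuasimetric α a b := by
  refine chainDist_le_mul hα hα1 haN (fun y hy => (hi y hy).1) (by linarith) fun x hx y hy => ?_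
  obtain ⟨h1, h2⟩ := hi y hy
  by_cases hxi : x = i y
  · rw [hxi, dist_self, zero_add]
    nlinarith [dist_nonneg (x := i y) (y := y)]
  · have h3 := hsep x hx _ h1 hxi
    have h4 := dist_triangle x y (i y)
    rw [dist_comm y] at h4
    have h5 : η * (δ - r) ≤ η * dist x y := mul_le_mul_of_nonneg_left (by linarith) hη
    linarith

/-- Every plan supplies `y` from atoms at least as far away as `i y`, so by subadditivity none beats
the direct moves. These need no spare atom in `a`. -/
lemma chainDist_le_of_matching (hα : 0 ≤ α) (hα1 : α ≤ 1) {a b : AtomicProb N Y} {i : Y → Y}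
    (hi : ∀ y ∈ b.1.support, ∀ x ∈ a.1.support, dist (i y) y ≤ dist x y)
    (hmatch : ∑ y ∈ b.1.support, Finsupp.single (i y) (b.1 y) = a.1) :
    chainDist α a b ≤ transportQuasimetric α a b := by
  have hk := chain_star (α := α) b.2.1 b.2.2.2 i
  rw [hmatch] at hk
  refine (chainDist_le hk).trans (le_transportQuasimetric fun γ hγ => ?_)
  rw [Plan.cost_eq hγ, Finset.sum_comm]
  refine Finset.sum_le_sum fun y hy => (wt_mul_le_sum hα hα1 hγ hy dist_nonneg).trans ?_
  exact Finset.sum_le_sum fun x hx =>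
    mul_le_mul_of_nonneg_left (hi y hy x hx) (wt_nonneg (hγ.1 _))

/-- Near every atom of `a` there are atoms of the measures close to `a`. -/
lemma exists_atoms_near (hα : 0 ≤ α) (hα1 : α ≤ 1) (a : AtomicProb N Y) {r : ℝ} (hr : 0 < r) :
    ∃ ε > 0, ∀ b : AtomicProb N Y, transportQuasimetric α a b < ε →
      ∀ x ∈ a.1.support, ∃ y ∈ b.1.support, dist x y < r := by
  obtain ⟨x₀, hx₀, hmin⟩ := a.1.support.exists_min_image (fun x => wt α (a.1 x))
    (Finsupp.support_nonempty_iff.2 a.ne_zero)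
  have hpos : ∀ x ∈ a.1.support, 0 < a.1 x := fun x hx =>
    lt_of_le_of_ne (a.2.1 x) (Ne.symm (Finsupp.mem_support_iff.1 hx))
  -- At a smaller cost not even the lightest atom can travel the distance `r`.
  refine ⟨r * wt α (a.1 x₀), mul_pos hr (wt_pos (hpos x₀ hx₀)), fun b hb x hx => ?_⟩
  by_contra! hcon
  have hxb : b.1 x = 0 := by
    by_contra h
    have := hcon x (Finsupp.mem_support_iff.2 h)
    rw [dist_self] at this
    linarith
  have h1 := transportQuasimetric_cut hα hα1 a b {x} hr.le fun p hp q hq hpq => by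
    rw [mem_singleton_iff, mem_singleton_iff] at hpq
    by_cases hpx : p = x
    · rw [hpx]; exact hcon q hq
    · have hqx : q = x := by tauto
      exact absurd hxb (hqx ▸ Finsupp.mem_support_iff.1 hq)
  rw [pairing_indicator_singleton, pairing_indicator_singleton, hxb, sub_zero,
    abs_of_nonneg (a.2.1 x)] at h1
  have := mul_le_mul_of_nonneg_left (hmin x hx) hr.le
  linarith

/-- Measures close to `a` with the same number of atoms have all their atoms near those of `a`. -/
lemma exists_matching_near (hα : 0 ≤ α) (hα1 : α ≤ 1) (a : AtomicProb N Y) {δ r : ℝ} (hr : 0 < r)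
    (hrδ : 2 * r ≤ δ) (hsep : ∀ p ∈ a.1.support, ∀ q ∈ a.1.support, p ≠ q → δ ≤ dist p q) :
    ∃ ε > 0, ∀ b : AtomicProb N Y, transportQuasimetric α a b < ε →
      b.1.support.card ≤ a.1.support.card →
      ∃ i : Y → Y, ∀ y ∈ b.1.support, i y ∈ a.1.support ∧ dist (i y) y < r := by
  classical
  obtain ⟨ε, hε, hnear⟩ := exists_atoms_near hα hα1 a hr
  refine ⟨ε, hε, fun b hb hcard => ?_⟩
  choose! g hg1 hg2 using hnear b hb
  have hinj : Set.InjOn g a.1.support := fun x hx x' hx' hxx' => by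
    by_contra hne
    have h1 := hsep x hx x' hx' hne
    have h2 := hg2 x hx
    have h3 := hg2 x' hx'
    rw [← hxx'] at h3
    have h4 := dist_triangle_right x x' (g x)
    linarith
  -- The map `g` is injective by separation, hence onto by the bound on the number of atoms.
  have himg : a.1.support.image g = b.1.support :=
    Finset.eq_of_subset_of_card_le (Finset.image_subset_iff.2 hg1)
      (by rwa [Finset.card_image_of_injOn hinj])
  have h : ∀ y ∈ b.1.support, ∃ x, x ∈ a.1.support ∧ dist x y < r := by
    intro y hy
    rw [← himg] at hy
    obtain ⟨x, hx, rfl⟩ := Finset.mem_image.1 hy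
    exact ⟨x, hx, hg2 x hx⟩
  choose! i hi using h
  exact ⟨i, hi⟩

end Comparison

/-! ### Lipschitz curves and the chain distance -/

section LipschitzCurves

/-- m = m^(1-α) m^α, and since α < 1 the first factor is at most `θ` for m ≤ θ^(1/(1-α)). -/
lemma exists_wt_small {α : ℝ} (hα : 0 ≤ α) (hα1 : α < 1) {θ : ℝ} (hθ : 0 < θ) :
    ∃ η > 0, ∀ m, 0 ≤ m → wt α m < η → m ≤ θ * wt α m := by
  have h1 : 0 < 1 - α := by linarith
  set m₀ := θ ^ (1 / (1 - α)) with hm₀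
  have hm₀pos : 0 < m₀ := Real.rpow_pos_of_pos hθ _
  refine ⟨wt α m₀, wt_pos hm₀pos, fun m hm hlt => ?_⟩
  rcases hm.eq_or_lt with rfl | hmpos
  · simp
  have hmlt : m < m₀ := by
    by_contra! hle
    exact absurd (wt_mono hα hm₀pos.le hle) (not_le.2 hlt)
  rw [wt_of_ne_zero hmpos.ne']
  have h2 : m ^ (1 - α) ≤ θ := by
    calc m ^ (1 - α) ≤ m₀ ^ (1 - α) := Real.rpow_le_rpow hm hmlt.le h1.le
      _ = θ := by rw [hm₀, ← Real.rpow_mul hθ.le, one_div_mul_cancel h1.ne', Real.rpow_one]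
  calc m = m ^ (1 - α) * m ^ α := by
        rw [← Real.rpow_add hmpos, sub_add_cancel, Real.rpow_one]
    _ ≤ θ * m ^ α := mul_le_mul_of_nonneg_right h2 (Real.rpow_nonneg hm _)

/-- Masses that change at a Lipschitz cost do not change at all. -/
lemma eq_of_wt_abs_sub_le {α : ℝ} (hα : 0 ≤ α) (hα1 : α < 1) {h : ℝ → ℝ} {p q K : ℝ}
    (hK : 0 ≤ K)
    (H : ∀ s ∈ Icc p q, ∀ t ∈ Icc p q, wt α |h s - h t| ≤ K * |s - t|) :
    ∀ t ∈ Icc p q, h t = h p := by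
  -- A small change is negligible against its weight, which is O(|s - t|); so the change is o(|s -
  -- t|).
  have hderiv : ∀ t ∈ Icc p q, HasDerivWithinAt h 0 (Icc p q) t := by
    intro t ht
    rw [hasDerivWithinAt_iff_isLittleO]
    rw [Asymptotics.isLittleO_iff]
    intro c hc
    obtain ⟨η, hη, hsmall⟩ := exists_wt_small hα hα1 (θ := c / (K + 1)) (by positivity)
    have hnear : ∀ᶠ s in 𝓝[Icc p q] t, |s - t| < η / (K + 1) := by
      have : Metric.ball t (η / (K + 1)) ∈ 𝓝 t := Metric.ball_mem_nhds _ (by positivity)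
      filter_upwards [mem_nhdsWithin_of_mem_nhds this] with s hs
      rwa [Metric.mem_ball, Real.dist_eq] at hs
    filter_upwards [hnear, self_mem_nhdsWithin] with s hs hsI
    have h1 := H s hsI t ht
    have h2 : K * |s - t| ≤ (K + 1) * |s - t| := by nlinarith [abs_nonneg (s - t)]
    have h3 : (K + 1) * |s - t| < η := by rwa [lt_div_iff₀' (by linarith)] at hs
    have h4 := hsmall _ (abs_nonneg _) (lt_of_le_of_lt h1 (h2.trans_lt h3))
    rw [smul_zero, sub_zero, Real.norm_eq_abs, Real.norm_eq_abs]
    calc |h s - h t| ≤ c / (K + 1) * wt α |h s - h t| := h4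
      _ ≤ c / (K + 1) * ((K + 1) * |s - t|) :=
          mul_le_mul_of_nonneg_left (h1.trans h2) (by positivity)
      _ = c * |s - t| := by field_simp
  refine constant_of_derivWithin_zero (fun t ht => (hderiv t ht).differentiableWithinAt)
    fun t ht => ?_
  have hpq : p < q := lt_of_le_of_lt ht.1 ht.2
  exact (hderiv t (Ico_subset_Icc_self ht)).derivWithin
    (uniqueDiffOn_Icc hpq t (Ico_subset_Icc_self ht))

variable {Y : Type*} [MetricSpace Y] {N : ℕ} {α : ℝ}

/-- Along a Lipschitz curve, near a measure with `N` atoms the masses are constant. -/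
lemma chainDist_le_near_of_card_eq (hα : 0 ≤ α) (hα1 : α < 1) {f : ℝ → AtomicProb N Y}
    {p q C : ℝ} (hC : 0 ≤ C)
    (H : ∀ s ∈ Icc p q, ∀ t ∈ Icc p q, transportQuasimetric α (f s) (f t) ≤ C * |s - t|)
    {t : ℝ} (ht : t ∈ Icc p q) (hcard : (f t).1.support.card = N) :
    ∃ ε > 0, ∀ s ∈ Icc p q, |s - t| < ε →
      chainDist α (f t) (f s) ≤ transportQuasimetric α (f t) (f s) := by
  classical
  obtain ⟨δ, hδ, hsep⟩ := exists_pos_separation (f t).1.support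
  -- Atoms of nearby measures lie within `r` of the atoms of `f t`; with this choice those near
  -- different atoms are at least `r` apart.
  set r := δ / 4 with hr
  have hrpos : 0 < r := by positivity
  obtain ⟨ε, hε, hmatch⟩ := exists_matching_near hα hα1.le (f t) hrpos (by linarith) hsep
  have hclose : ∀ s ∈ Icc p q, |s - t| < ε / (C + 1) →
      ∃ i : Y → Y, ∀ y ∈ (f s).1.support, i y ∈ (f t).1.support ∧ dist (i y) y < r := by
    intro s hs hst
    refine hmatch (f s) ?_ ((f s).2.2.2.trans_eq hcard.symm)
    have h1 := H t ht s hs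
    rw [lt_div_iff₀' (by linarith)] at hst
    rw [abs_sub_comm] at h1
    nlinarith [abs_nonneg (s - t)]
  refine ⟨ε / (C + 1), by positivity, fun s hs hst => ?_⟩
  obtain ⟨i, hi⟩ := hclose s hs hst
  -- the mass near each atom is constant
  have hmass : ∀ x ∈ (f t).1.support, pairing ((Metric.ball x r).indicator 1) (f s).1 =
      pairing ((Metric.ball x r).indicator 1) (f t).1 := by
    intro x hx
    have hsub : ∀ u ∈ Icc (min s t) (max s t), u ∈ Icc p q ∧ |u - t| < ε / (C + 1) := by
      intro u hu
      refine ⟨⟨(le_min hs.1 ht.1).trans hu.1, hu.2.trans (max_le hs.2 ht.2)⟩,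
        lt_of_le_of_lt ?_ hst⟩
      rcases le_total s t with h | h
      · rw [min_eq_left h, max_eq_right h] at hu
        rw [abs_of_nonpos (by linarith [hu.2]), abs_of_nonpos (by linarith)]
        linarith [hu.1]
      · rw [min_eq_right h, max_eq_left h] at hu
        rw [abs_of_nonneg (by linarith [hu.1]), abs_of_nonneg (by linarith)]
        linarith [hu.2]
    -- Mass that enters or leaves the ball travels at least `r`. So the weight of any change is at
    -- most `C / r * |u - v|`, at all times between `s` and `t`.
    have hconst := eq_of_wt_abs_sub_le hα hα1
      (h := fun u => pairing ((Metric.ball x r).indicator 1) (f u).1)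
      (p := min s t) (q := max s t) (K := C / r) (by positivity) fun u hu v hv => by
        obtain ⟨hu1, hu2⟩ := hsub u hu
        obtain ⟨hv1, hv2⟩ := hsub v hv
        obtain ⟨iu, hiu⟩ := hclose u hu1 hu2
        obtain ⟨iv, hiv⟩ := hclose v hv1 hv2
        have gap : ∀ y z w, w ∈ (f t).1.support → dist w z < r → y ∈ Metric.ball x r →
            z ∉ Metric.ball x r → r ≤ dist y z := by
          intro y z w hw hwz hy hz
          have hne : x ≠ w := by
            rintro rfl
            rw [Metric.mem_ball, dist_comm] at hz
            exact hz hwz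
          have h1 := hsep x hx w hw hne
          rw [Metric.mem_ball, dist_comm] at hy
          have h2 := dist_triangle4 x y z w
          rw [dist_comm z w] at h2
          linarith
        have h1 := transportQuasimetric_cut hα hα1.le (f u) (f v) (Metric.ball x r) hrpos.le
          fun y hy z hz hyz => by
            by_cases hyA : y ∈ Metric.ball x r
            · exact gap y z _ (hiv z hz).1 (hiv z hz).2 hyA (by tauto)
            · rw [dist_comm]
              exact gap z y _ (hiu y hy).1 (hiu y hy).2 (by tauto) hyA
        rw [div_mul_eq_mul_div, le_div_iff₀' hrpos]
        exact h1.trans (H u hu1 v hv1)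
    exact (hconst s ⟨min_le_left _ _, le_max_left _ _⟩).trans
      (hconst t ⟨min_le_right _ _, le_max_right _ _⟩).symm
  have hball : ∀ x ∈ (f t).1.support, ∀ y ∈ (f s).1.support, y ∈ Metric.ball x r ↔ i y = x := by
    intro x hx y hy
    obtain ⟨h1, h2⟩ := hi y hy
    constructor
    · intro hyx
      by_contra hne
      have h3 := hsep _ h1 x hx hne
      rw [Metric.mem_ball] at hyx
      have h4 := dist_triangle (i y) y x
      linarith
    · rintro rfl
      rwa [Metric.mem_ball, dist_comm]
  refine chainDist_le_of_matching hα hα1.le (i := i) (fun y hy x hx => ?_) ?_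
  · obtain ⟨h1, h2⟩ := hi y hy
    by_cases hxi : i y = x
    · rw [hxi]
    · have h3 := hsep _ h1 x hx hxi
      have h4 := dist_triangle (i y) y x
      rw [dist_comm y] at h4
      linarith
  · ext x
    rw [Finsupp.finsetSum_apply]
    by_cases hx : x ∈ (f t).1.support
    · have h1 := hmass x hx
      rw [pairing_eq_sum _ subset_rfl, pairing_eq_sum _ (a := (f t).1) subset_rfl,
        Finset.sum_eq_single_of_mem x hx] at h1
      · rw [indicator_of_mem (Metric.mem_ball_self hrpos), Pi.one_apply, mul_one] at h1
        rw [← h1]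
        refine Finset.sum_congr rfl fun y hy => ?_
        have h2 := hball x hx y hy
        by_cases hyx : i y = x
        · rw [indicator_of_mem (h2.2 hyx), hyx]; simp
        · rw [indicator_of_notMem (fun h => hyx (h2.1 h)), Finsupp.single_eq_of_ne (Ne.symm hyx),
            mul_zero]
      · intro z hz hzx
        rw [indicator_of_notMem, mul_zero]
        rw [Metric.mem_ball, not_lt]
        linarith [hsep z hz x hx hzx]
    · rw [Finsupp.notMem_support_iff.1 hx]
      refine Finset.sum_eq_zero fun y hy => Finsupp.single_eq_of_ne ?_
      rintro rfl
      exact hx (hi y hy).1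

/-- Along a Lipschitz curve, the chain distance and `J_α` agree to first order between measures
with the same number of atoms. -/
lemma chainDist_le_near_of_card_lt (hα : 0 ≤ α) (hα1 : α < 1) {f : ℝ → AtomicProb N Y}
    {p q C : ℝ} (hC : 0 ≤ C)
    (H : ∀ s ∈ Icc p q, ∀ t ∈ Icc p q, transportQuasimetric α (f s) (f t) ≤ C * |s - t|)
    {t : ℝ} (ht : t ∈ Icc p q) (hcard : (f t).1.support.card < N) {η : ℝ} (hη : 0 < η) :
    ∃ ε > 0, ∀ s ∈ Icc p q, |s - t| < ε → (f s).1.support.card ≤ (f t).1.support.card →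
      chainDist α (f t) (f s) ≤ (1 + η) * transportQuasimetric α (f t) (f s) := by
  obtain ⟨δ, hδ, hsep⟩ := exists_pos_separation (f t).1.support
  -- Chosen so that 2r ≤ η(δ - r).
  set r := δ * η / (2 * (1 + η)) with hr
  have hrpos : 0 < r := by positivity
  have hr1 : 2 * r * (1 + η) = δ * η := by rw [hr]; field_simp
  obtain ⟨ε, hε, hmatch⟩ := exists_matching_near hα hα1.le (f t) hrpos (by nlinarith) hsep
  refine ⟨ε / (C + 1), by positivity, fun s hs hst hle => ?_⟩
  obtain ⟨i, hi⟩ := hmatch (f s) (by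
    have h1 := H t ht s hs
    rw [lt_div_iff₀' (by linarith)] at hst
    rw [abs_sub_comm] at h1
    nlinarith [abs_nonneg (s - t)]) hle
  exact chainDist_le_one_add_mul hα hα1.le hcard hη.le (by nlinarith) hsep
    fun y hy => ⟨(hi y hy).1, (hi y hy).2.le⟩

end LipschitzCurves

/-! ### Functions dominated by a metric derivative -/

section MetricDerivative

/-- A pointwise Lipschitz bound on an interval is a Lipschitz bound. -/
lemma abs_sub_le_of_eventually {V : ℝ → ℝ} {p q K : ℝ}
    (h : ∀ t ∈ Icc p q, ∀ᶠ s in 𝓝[Icc p q] t, |V s - V t| ≤ K * |s - t|) :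
    ∀ s ∈ Icc p q, ∀ t ∈ Icc p q, |V s - V t| ≤ K * |s - t| := by
  have hcont : ContinuousOn V (Icc p q) := by
    intro t ht
    have h0 : Tendsto (fun s => K * |s - t|) (𝓝[Icc p q] t) (𝓝 0) := by
      have : Tendsto (fun s => K * |s - t|) (𝓝 t) (𝓝 (K * |t - t|)) :=
        (Continuous.tendsto (by fun_prop) t)
      rw [sub_self, abs_zero, mul_zero] at this
      exact this.mono_left nhdsWithin_le_nhds
    have h1 : Tendsto (fun s => V s - V t) (𝓝[Icc p q] t) (𝓝 0) :=
      squeeze_zero_norm' (h t ht) h0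
    have h2 := h1.add_const (V t)
    simpa [ContinuousWithinAt] using h2
  have key : ∀ s t, s ∈ Icc p q → t ∈ Icc p q → s ≤ t → |V t - V s| ≤ K * |t - s| := by
    intro s t hs ht hst
    rw [abs_of_nonneg (sub_nonneg.2 hst)]
    refine le_of_forall_pos_le_add fun ε hε => ?_
    have hsub : Icc s t ⊆ Icc p q := Icc_subset_Icc hs.1 ht.2
    -- The comparison with a boundary function needs a strictly larger slope than `K`; the slack `e`
    -- costs at most `ε` in total.
    set e := ε / (t - s + 1) with he
    have hden : 0 < t - s + 1 := by linarith
    have hepos : 0 < e := by positivity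
    have := image_norm_le_of_liminf_right_slope_norm_lt_deriv_boundary (a := s) (b := t)
      (f := fun u => V u - V s) (f' := fun _ => K) (B := fun u => (K + e) * (u - s))
      (B' := fun _ => K + e) ((hcont.mono hsub).sub continuousOn_const)
      (fun u hu r hr => ?_) (by simp) (by fun_prop)
      (fun u _ => by simpa using (((hasDerivAt_id u).sub_const s).const_mul (K + e)).hasDerivWithinAt)
      (fun u _ _ => by linarith) (x := t) ⟨hst, le_rfl⟩
    · rw [Real.norm_eq_abs] at this
      refine this.trans ?_
      have : e * (t - s) ≤ ε := by
        rw [he, div_mul_eq_mul_div, div_le_iff₀ hden]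
        nlinarith
      linarith
    · have hu' : u ∈ Icc p q := hsub (Ico_subset_Icc_self hu)
      have hle : 𝓝[Ioo u t] u ≤ 𝓝[Icc p q] u :=
        nhdsWithin_mono u fun v hv => hsub ⟨hu.1.trans hv.1.le, hv.2.le⟩
      have hev : ∀ᶠ v in 𝓝[>] u, |V v - V u| ≤ K * |v - u| := by
        rw [← nhdsWithin_Ioo_eq_nhdsGT hu.2]
        exact hle (h u hu')
      refine Eventually.frequently ?_
      filter_upwards [hev, self_mem_nhdsWithin] with v hv hvu
      have hvu : u < v := hvu
      refine lt_of_le_of_lt ?_ hr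
      rw [slope_def_field, div_le_iff₀ (by linarith)]
      rw [abs_of_pos (sub_pos.2 hvu)] at hv
      refine le_trans ?_ hv
      simp only [Function.comp, Real.norm_eq_abs]
      refine (abs_sub_abs_le_abs_sub _ _).trans ?_
      rw [sub_sub_sub_cancel_right]
  intro s hs t ht
  rcases le_total s t with hst | hst
  · rw [abs_sub_comm, abs_sub_comm s]; exact key s t hs ht hst
  · exact key t s ht hs hst

/-- The slopes of `V` converge and the metric derivative is an upper limit, so a comparison at some
times arbitrarily close to `t` suffices. -/
lemma enorm_deriv_le_metricDeriv {X : Type*} {J : X → X → ℝ} {f : ℝ → X} {V : ℝ → ℝ} {v t : ℝ}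
    (hJ : ∀ x y, 0 ≤ J x y) (ht : t ∈ Ioo (0 : ℝ) 1) (hV : HasDerivAt V v t)
    (h : ∀ η > 0, ∃ᶠ s in 𝓝[≠] t, |V s - V t| ≤ (1 + η) * J (f s) (f t)) :
    ‖v‖ₑ ≤ metricDeriv J f 0 1 t := by
  by_contra! hlt
  obtain ⟨c, hc1, hc2⟩ := ENNReal.lt_iff_exists_nnreal_btwn.1 hlt
  have hfil : 𝓝[Icc (0 : ℝ) 1 \ {t}] t = 𝓝[≠] t := by
    rw [sdiff_eq, inter_comm, nhdsWithin_inter_of_mem' (mem_nhdsWithin_of_mem_nhds (Icc_mem_nhds ht.1 ht.2))]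
  rw [metricDeriv, hfil] at hc1
  have h1 := eventually_lt_of_limsup_lt hc1
  have hcv : (c : ℝ) < |v| := by
    rw [← ofReal_norm, ← ENNReal.ofReal_coe_nnreal,
      ENNReal.ofReal_lt_ofReal_iff_of_nonneg c.coe_nonneg] at hc2
    exact hc2
  obtain ⟨η, hη, hηc⟩ : ∃ η > 0, (1 + η) * (c : ℝ) < |v| := by
    refine ⟨(|v| - c) / (2 * (c + 1)), by have := c.2; have := sub_pos.2 hcv; positivity, ?_⟩
    have hc0 : (0 : ℝ) ≤ c := c.2
    have : (|v| - c) / (2 * (c + 1)) * c < |v| - c := by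
      rw [div_mul_eq_mul_div, div_lt_iff₀ (by positivity)]
      nlinarith [sub_pos.2 hcv]
    linarith
  have h2 : ∀ᶠ s in 𝓝[≠] t, (1 + η) * (c : ℝ) < |slope V t s| :=
    (hasDerivAt_iff_tendsto_slope.1 hV).abs.eventually_const_lt hηc
  obtain ⟨s, hs, hs1, hs2, hs3⟩ :=
    ((h η hη).and_eventually (h1.and (h2.and self_mem_nhdsWithin))).exists
  have hst : 0 < |s - t| := abs_pos.2 (sub_ne_zero.2 hs3)
  rw [← ENNReal.ofReal_coe_nnreal, ENNReal.ofReal_lt_ofReal_iff_of_nonneg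
    (div_nonneg (hJ _ _) hst.le), div_lt_iff₀ hst] at hs1
  rw [slope_def_field, abs_div, lt_div_iff₀ hst] at hs2
  nlinarith

lemma ofReal_sub_le_lintegral {V : ℝ → ℝ} {p q K : ℝ} (hpq : p ≤ q) (hK : 0 ≤ K)
    (hV : ∀ s ∈ Icc p q, ∀ t ∈ Icc p q, |V s - V t| ≤ K * |s - t|) {g : ℝ → ENNReal}
    (hg : ∀ᵐ t, t ∈ Ioo p q → ∀ v, HasDerivAt V v t → ‖v‖ₑ ≤ g t) :
    ENNReal.ofReal (V q - V p) ≤ ∫⁻ t in Ioc p q, g t := by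
  have hLip : LipschitzOnWith ⟨K, hK⟩ V (uIcc p q) := by
    rw [uIcc_of_le hpq]
    exact LipschitzOnWith.of_dist_le_mul fun s hs t ht => hV s hs t ht
  have hAC := hLip.absolutelyContinuousOnInterval
  rw [← hAC.integral_deriv_eq_sub, intervalIntegral.integral_of_le hpq]
  calc ENNReal.ofReal (∫ t in Ioc p q, deriv V t)
      ≤ ‖∫ t in Ioc p q, deriv V t‖ₑ := by
        rw [← ofReal_norm]; exact ENNReal.ofReal_le_ofReal (le_abs_self _)
    _ ≤ ∫⁻ t in Ioc p q, ‖deriv V t‖ₑ := enorm_integral_le_lintegral_enorm _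
    _ ≤ ∫⁻ t in Ioc p q, g t := by
        rw [← restrict_Ioo_eq_restrict_Ioc]
        refine lintegral_mono_ae ((ae_restrict_iff' measurableSet_Ioo).2 ?_)
        filter_upwards [hg, hAC.ae_differentiableAt] with t h1 h2 ht
        exact h1 ht _ (h2 (by rw [uIcc_of_le hpq]; exact Ioo_subset_Icc_self ht)).hasDerivAt

variable {Y : Type*} [MetricSpace Y] {N : ℕ} {α : ℝ}

/-- The length of a Lipschitz piece bounds the chain distance of its end points. -/
lemma chainDist_le_lintegral (hα : 0 ≤ α) (hα1 : α < 1) {f : ℝ → AtomicProb N Y}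
    {p q C : ℝ} (hp : 0 ≤ p) (hpq : p ≤ q) (hq : q ≤ 1) (hC : 0 ≤ C)
    (H : ∀ s ∈ Icc p q, ∀ t ∈ Icc p q, transportQuasimetric α (f s) (f t) ≤ C * |s - t|) :
    ENNReal.ofReal (chainDist α (f p) (f q)) ≤
      ∫⁻ t in Ioc p q, metricDeriv (transportQuasimetric α) f 0 1 t := by
  set V : ℝ → ℝ := fun t => chainDist α (f p) (f t) with hVdef
  have hVle : ∀ s t, |V s - V t| ≤ chainDist α (f t) (f s) := by
    intro s t
    have h1 := chainDist_triangle (α := α) (f p) (f s) (f t)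
    have h2 := chainDist_triangle (α := α) (f p) (f t) (f s)
    rw [chainDist_symm (f s)] at h2
    exact abs_sub_le_iff.2 ⟨by simp only [hVdef]; linarith, by simp only [hVdef]; linarith⟩
  have hnear : ∀ {t ε : ℝ} (S : Set ℝ), 0 < ε → ∀ᶠ s in 𝓝[S] t, |s - t| < ε := by
    intro t ε S hε
    filter_upwards [mem_nhdsWithin_of_mem_nhds (Metric.ball_mem_nhds t hε)] with s hs
    rwa [Metric.mem_ball, Real.dist_eq] at hs
  have hLip : ∀ s ∈ Icc p q, ∀ t ∈ Icc p q, |V s - V t| ≤ 3 * C * |s - t| := by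
    refine abs_sub_le_of_eventually fun t ht => ?_
    rcases (f t).2.2.2.lt_or_eq with hcard | hcard
    · filter_upwards [self_mem_nhdsWithin] with s hs
      have h1 := chainDist_le_three_mul hα hα1.le (b := f s) hcard
      have h2 := H t ht s hs
      rw [abs_sub_comm] at h2
      linarith [hVle s t]
    · obtain ⟨ε, hε, h⟩ := chainDist_le_near_of_card_eq hα hα1 hC H ht hcard
      filter_upwards [hnear _ hε, self_mem_nhdsWithin] with s hs hsI
      have h1 := h s hsI hs
      have h2 := H t ht s hsI
      rw [abs_sub_comm] at h2
      have h3 := mul_nonneg hC (abs_nonneg (s - t))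
      linarith [hVle s t]
  have hmain := ofReal_sub_le_lintegral hpq (by positivity) hLip
    (g := metricDeriv (transportQuasimetric α) f 0 1) ?_
  · simpa [hVdef, chainDist_self] using hmain
  let S : ℕ → Set ℝ := fun n => {t | (f t).1.support.card = n}
  -- A set of reals has only countably many points isolated from the right. At all other `t`, times
  -- with the same number of atoms accumulate from the right.
  have hcount : (⋃ n, {t ∈ S n | 𝓝[S n ∩ Ioi t] t = ⊥}).Countable :=
    countable_iUnion fun n => countable_setOfPred_isolated_right_within
  filter_upwards [hcount.ae_notMem volume] with t hiso ht v hv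
  have htI := Ioo_subset_Icc_self ht
  have hIcc : Icc p q ∈ 𝓝 t := Icc_mem_nhds ht.1 ht.2
  refine enorm_deriv_le_metricDeriv transportQuasimetric_nonneg
    ⟨hp.trans_lt ht.1, ht.2.trans_le hq⟩ hv fun η hη => ?_
  rcases (f t).2.2.2.lt_or_eq with hcard | hcard
  · obtain ⟨ε, hε, h⟩ := chainDist_le_near_of_card_lt hα hα1 hC H htI hcard hη
    have hne : (𝓝[S (f t).1.support.card ∩ Ioi t] t).NeBot := by
      refine ⟨fun hbot => hiso (mem_iUnion.2 ⟨(f t).1.support.card, rfl, hbot⟩)⟩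
    have hle : 𝓝[S (f t).1.support.card ∩ Ioi t] t ≤ 𝓝[≠] t :=
      nhdsWithin_mono t fun s hs => ne_of_gt hs.2
    refine Frequently.filter_mono (Eventually.frequently ?_) hle
    filter_upwards [hnear _ hε, self_mem_nhdsWithin, mem_nhdsWithin_of_mem_nhds hIcc]
      with s hs hsS hsI
    refine (hVle s t).trans ?_
    rw [transportQuasimetric_symm (f s)]
    exact h s hsI hs (le_of_eq hsS.1)
  · obtain ⟨ε, hε, h⟩ := chainDist_le_near_of_card_eq hα hα1 hC H htI hcard
    refine Eventually.frequently ?_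
    filter_upwards [hnear _ hε, mem_nhdsWithin_of_mem_nhds hIcc] with s hs hsI
    refine (hVle s t).trans ((h s hsI hs).trans ?_)
    rw [transportQuasimetric_symm (f s)]
    nlinarith [transportQuasimetric_nonneg (α := α) (f t) (f s)]

/-- The length of a piecewise metric Lipschitz curve bounds the chain distance of its end
points. -/
lemma chainDist_le_curveLength (hα : 0 ≤ α) (hα1 : α < 1) {k : ℕ} {a b : AtomicProb N Y}
    {f : ℝ → AtomicProb N Y} (hf : f ∈ PathSet (transportQuasimetric α) k a b) :
    ENNReal.ofReal (chainDist α a b) ≤ curveLength (transportQuasimetric α) f 0 1 := by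
  obtain ⟨⟨-, p, hp0, hpk, hp⟩, rfl, rfl⟩ := hf
  have hmono : ∀ i ≤ k, ∀ j ≤ i, p j ≤ p i := by
    intro i
    induction i with
    | zero => intro _ j hj; rw [Nat.le_zero.1 hj]
    | succ i ih =>
      intro hi j hj
      rcases hj.lt_or_eq with hj | rfl
      · exact (ih (by omega) j (by omega)).trans (hp i (by omega)).1.le
      · exact le_rfl
  have key : ∀ i ≤ k, ENNReal.ofReal (chainDist α (f 0) (f (p i))) ≤
      ∫⁻ t in Ioc 0 (p i), metricDeriv (transportQuasimetric α) f 0 1 t := by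
    intro i
    induction i with
    | zero => intro _; rw [hp0, chainDist_self]; simp
    | succ i ih =>
      intro hi
      obtain ⟨hlt, -, C, hC, hL⟩ := hp i (by omega)
      have h0 : 0 ≤ p i := hp0 ▸ hmono i (by omega) 0 (Nat.zero_le _)
      have h1 : p (i + 1) ≤ 1 := hpk ▸ hmono k le_rfl (i + 1) hi
      rw [← Ioc_union_Ioc_eq_Ioc h0 hlt.le,
        lintegral_union measurableSet_Ioc (Ioc_disjoint_Ioc_of_le le_rfl)]
      refine le_trans ?_ (add_le_add (ih (by omega))
        (chainDist_le_lintegral hα hα1 h0 hlt.le h1 hC hL))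
      rw [← ENNReal.ofReal_add (chainDist_nonneg _ _) (chainDist_nonneg _ _)]
      exact ENNReal.ofReal_le_ofReal (chainDist_triangle _ _ _)
  have := key k le_rfl
  rw [hpk] at this
  exact this.trans (lintegral_mono_set Ioc_subset_Icc_self)

end MetricDerivative

/-! ### Realizing chains by curves -/

section Realization

variable {Y : Type*} [MetricSpace Y]

/-- In a geodesic space any two points are joined by a geodesic of constant speed. -/
lemma IsGeodesicSpace.exists_const_speed (hY : IsGeodesicSpace Y) (x y : Y) :
    ∃ Γ : ℝ → Y, Γ 0 = x ∧ Γ 1 = y ∧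
      ∀ s ∈ Icc (0 : ℝ) 1, ∀ t ∈ Icc (0 : ℝ) 1, dist (Γ s) (Γ t) = |s - t| * dist x y := by
  obtain ⟨Γ, ⟨K, hK⟩, h0, h1, hvar⟩ := hY x y
  set D := dist x y with hD
  -- The length of the curve is d(x,y), so the triangle inequalities along it are equalities and `g`
  -- is its arc length.
  set g : ℝ → ℝ := fun t => dist x (Γ t) with hg
  have hsum : ∀ s t, 0 ≤ s → s ≤ t → t ≤ 1 →
      dist x (Γ s) + dist (Γ s) (Γ t) + dist (Γ t) y ≤ D := by
    intro s t hs hst ht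
    have e1 := eVariationOn.Icc_add_Icc Γ hs (hst.trans ht) (mem_univ s)
    have e2 := eVariationOn.Icc_add_Icc Γ hst ht (mem_univ t)
    simp only [univ_inter] at e1 e2
    have b1 := eVariationOn.edist_le Γ (left_mem_Icc.2 hs) (right_mem_Icc.2 hs)
    have b2 := eVariationOn.edist_le Γ (left_mem_Icc.2 hst) (right_mem_Icc.2 hst)
    have b3 := eVariationOn.edist_le Γ (left_mem_Icc.2 ht) (right_mem_Icc.2 ht)
    rw [h0] at b1
    rw [h1] at b3
    have : edist x (Γ s) + (edist (Γ s) (Γ t) + edist (Γ t) y) ≤ edist x y := by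
      rw [← hvar, ← e1, ← e2]
      exact add_le_add b1 (add_le_add b2 b3)
    rw [edist_dist, edist_dist, edist_dist, edist_dist, ← ENNReal.ofReal_add dist_nonneg
      dist_nonneg, ← ENNReal.ofReal_add dist_nonneg (add_nonneg dist_nonneg dist_nonneg),
      ENNReal.ofReal_le_ofReal_iff dist_nonneg] at this
    linarith
  have hmono : ∀ s t, 0 ≤ s → s ≤ t → t ≤ 1 → dist (Γ s) (Γ t) = g t - g s := by
    intro s t hs hst ht
    have h2 := hsum s t hs hst ht
    have h3 := dist_triangle x (Γ s) (Γ t)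
    have h4 := dist_triangle x (Γ t) y
    simp only [hg]
    linarith
  have hdist : ∀ s ∈ Icc (0 : ℝ) 1, ∀ t ∈ Icc (0 : ℝ) 1, dist (Γ s) (Γ t) = |g s - g t| := by
    intro s hs t ht
    rcases le_total s t with h | h
    · have h2 := hmono s t hs.1 h ht.2
      rw [abs_sub_comm, ← h2, abs_of_nonneg dist_nonneg]
    · have h2 := hmono t s ht.1 h hs.2
      rw [← h2, abs_of_nonneg dist_nonneg, dist_comm]
  have hcont : ContinuousOn g (Icc 0 1) := (continuous_const.dist continuous_id).comp_continuousOn hK.continuousOn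
  have hg0 : g 0 = 0 := by simp [hg, h0]
  have hg1 : g 1 = D := by simp [hg, h1, hD]
  have hex : ∀ r ∈ Icc (0 : ℝ) 1, ∃ t, t ∈ Icc (0 : ℝ) 1 ∧ g t = r * D := by
    intro r hr
    have hmem : r * D ∈ Icc (g 0) (g 1) := by
      rw [hg0, hg1]
      exact ⟨mul_nonneg hr.1 dist_nonneg, mul_le_of_le_one_left dist_nonneg hr.2⟩
    exact intermediate_value_Icc zero_le_one hcont hmem
  -- No regularity of `τ` is needed: distances along the curve depend only on `g`.
  choose! τ hτ1 hτ2 using hex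
  have hz : (0 : ℝ) ∈ Icc (0 : ℝ) 1 := ⟨le_rfl, zero_le_one⟩
  have ho : (1 : ℝ) ∈ Icc (0 : ℝ) 1 := ⟨zero_le_one, le_rfl⟩
  refine ⟨fun r => Γ (τ r), ?_, ?_, fun s hs t ht => ?_⟩
  · have := hdist _ (hτ1 0 hz) 0 hz
    rw [hτ2 0 hz, hg0, zero_mul, sub_zero, abs_zero, h0] at this
    exact dist_eq_zero.1 this
  · have := hdist _ (hτ1 1 ho) 1 ho
    rw [hτ2 1 ho, hg1, one_mul, sub_self, abs_zero, h1] at this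
    exact dist_eq_zero.1 this
  · rw [hdist _ (hτ1 s hs) _ (hτ1 t ht), hτ2 s hs, hτ2 t ht, ← sub_mul, abs_mul,
      abs_of_nonneg (dist_nonneg (x := x) (y := y))]

variable {N : ℕ} {α : ℝ}

/-- A chain can be prolonged by trivial moves. -/
lemma Chain.pad {k l : ℕ} (hkl : k ≤ l) {a : Y →₀ ℝ} {b : AtomicProb N Y} {c : ℝ}
    (h : Chain N α k a b.1 c) : Chain N α l a b.1 c := by
  classical
  induction l, hkl using Nat.le_induction with
  | base => exact h
  | succ l _ ih =>
    obtain ⟨z, hz⟩ := Finsupp.support_nonempty_iff.2 b.ne_zero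
    have hb : b.1 = b.1.erase z + Finsupp.single z (b.1 z) := by
      rw [add_comm]; exact (Finsupp.single_add_erase z b.1).symm
    have hm : IsMoveBy N (b.1.erase z) (b.1 z) z z b.1 b.1 := by
      refine ⟨fun w => ?_, b.2.1 z, ?_, hb, hb⟩
      · by_cases hw : w = z
        · simp [hw]
        · rw [Finsupp.erase_ne hw]; exact b.2.1 w
      · rw [Finsupp.support_erase]
        exact (Finset.card_lt_card (Finset.erase_ssubset hz)).trans_le b.2.2.2
    simpa using ih.snoc hm

namespace Network

variable {K : ℕ} {a b : AtomicProb N Y}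

lemma total_state {Y : Type*} {a b : AtomicProb N Y} (T : Network Y N K a.1 b.1) (l : ℕ) (hl : l ≤ K) :
    ((T.state l).sum fun _ m => m) = 1 := by
  induction l with
  | zero => rw [T.state_zero]; exact a.2.2.1
  | succ l ih =>
    have hm := T.isMoveBy l (by omega)
    refine Eq.trans ?_ (ih (by omega))
    rw [← pairing_one, ← pairing_one, hm.source, hm.target, pairing_add,
      pairing_add, pairing_single, pairing_single]

/-- The state in which the mass moved in the `l`-th move is at the point `z`. -/
def transit (T : Network Y N K a.1 b.1) (l : Fin K) (z : Y) : AtomicProb N Y :=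
  ⟨T.rest l + Finsupp.single z (T.mass l), by
    have hm := T.isMoveBy l l.2
    refine ⟨fun w => add_nonneg (hm.rest_nonneg w) (single_apply_nonneg hm.mass_nonneg _ _), ?_,
      card_support_add_single_le hm.card_lt _ _⟩
    refine Eq.trans ?_ (T.total_state l l.2.le)
    rw [← pairing_one, ← pairing_one, hm.source, pairing_add,
      pairing_add, pairing_single, pairing_single]⟩

lemma transportQuasimetric_transit (hα : 0 ≤ α) (hα1 : α ≤ 1) (T : Network Y N K a.1 b.1)
    (l : Fin K) (z w : Y) :
    transportQuasimetric α (T.transit l z) (T.transit l w) = wt α (T.mass l) * dist z w :=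
  transportQuasimetric_single_move hα hα1 (T.isMoveBy l l.2).rest_nonneg
    (T.isMoveBy l l.2).mass_nonneg rfl rfl

/-- The curve that performs the moves of a network one after the other, at times in `[0, K]`,
along the paths `Γ l`. -/
def curve (T : Network Y N K a.1 b.1) (Γ : ℕ → ℝ → Y) (u : ℝ) : AtomicProb N Y :=
  if h : ⌊u⌋₊ < K then T.transit ⟨⌊u⌋₊, h⟩ (Γ ⌊u⌋₊ (u - ⌊u⌋₊)) else b

lemma curve_natCast {Y : Type*} {a b : AtomicProb N Y} (T : Network Y N K a.1 b.1) {Γ : ℕ → ℝ → Y}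
    (h0 : ∀ l, Γ l 0 = T.tail l) (l : ℕ) (hl : l ≤ K) :
    (T.curve Γ l).1 = T.state l := by
  unfold curve
  rcases hl.lt_or_eq with hl | rfl
  · rw [dif_pos (by simpa using hl)]
    simp only [transit, Nat.floor_natCast, sub_self, h0]
    exact (T.isMoveBy l hl).source.symm
  · rw [dif_neg (by simp), T.state_last]

lemma curve_of_mem_Icc {Y : Type*} {a b : AtomicProb N Y} (T : Network Y N K a.1 b.1) {Γ : ℕ → ℝ → Y}
    (h0 : ∀ l, Γ l 0 = T.tail l) (h1 : ∀ l, Γ l 1 = T.head l) (l : Fin K) {u : ℝ}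
    (hu : u ∈ Icc (l : ℝ) (l + 1)) : T.curve Γ u = T.transit l (Γ l (u - l)) := by
  rcases hu.2.lt_or_eq with hlt | heq
  · have hfl : ⌊u⌋₊ = l := (Nat.floor_eq_iff ((Nat.cast_nonneg _).trans hu.1)).2 ⟨hu.1, hlt⟩
    unfold curve
    rw [dif_pos (by rw [hfl]; exact l.2)]
    simp only [hfl]
  -- At the right end the floor is already `l + 1`, so agreement with the next state has to be
  -- checked.
  · apply Subtype.ext
    have : u = ((l + 1 : ℕ) : ℝ) := by rw [heq]; push_cast; rfl
    rw [this, T.curve_natCast h0 _ l.2, (T.isMoveBy l l.2).target]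
    simp [transit, h1]

end Network

/-- A nonempty chain is realized by a curve whose length is at most its cost. -/
lemma Chain.exists_curve (hY : IsGeodesicSpace Y) (hα : 0 ≤ α) (hα1 : α ≤ 1) {K : ℕ}
    (hK : 1 ≤ K) {a b : AtomicProb N Y} {c : ℝ} (h : Chain N α K a.1 b.1 c) :
    ∃ f ∈ PathSet (transportQuasimetric α) K a b,
      curveLength (transportQuasimetric α) f 0 1 ≤ ENNReal.ofReal c := by
  obtain ⟨z₀, -⟩ := Finsupp.support_nonempty_iff.2 a.ne_zero
  have : Nonempty Y := ⟨z₀⟩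
  obtain ⟨T, rfl⟩ := h.exists_network
  choose Γ h0 h1 hΓ using fun l : ℕ => hY.exists_const_speed (T.tail l) (T.head l)
  have hKpos : (0 : ℝ) < K := by exact_mod_cast hK
  have hK1 : 1 ≤ N := by
    have := (T.isMoveBy 0 hK).card_lt
    omega
  have hquasi := isQuasimetric_transportQuasimetric (Y := Y) hα hα1 hK1
  let p : ℕ → ℝ := fun l => l / K
  let f : ℝ → AtomicProb N Y := fun t => T.curve Γ (K * t)
  let C : ℕ → ℝ := fun l => K * (wt α (T.mass l) * dist (T.tail l) (T.head l))
  have hCnn : ∀ l < K, 0 ≤ C l := fun l hl =>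
    mul_nonneg hKpos.le (mul_nonneg (wt_nonneg (T.isMoveBy l hl).mass_nonneg) dist_nonneg)
  have hmem : ∀ l, ∀ t ∈ Icc (p l) (p (l + 1)), K * t ∈ Icc (l : ℝ) (l + 1) := by
    intro l t ht
    have h2 := (div_le_iff₀' hKpos).1 ht.1
    have h3 := (le_div_iff₀' hKpos).1 ht.2
    push_cast at h3
    exact ⟨h2, h3⟩
  have hf : ∀ l (hl : l < K), ∀ t ∈ Icc (p l) (p (l + 1)),
      f t = T.transit ⟨l, hl⟩ (Γ l (K * t - l)) := fun l hl t ht =>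
    T.curve_of_mem_Icc h0 h1 ⟨l, hl⟩ (hmem l t ht)
  have hJ : ∀ l < K, ∀ s ∈ Icc (p l) (p (l + 1)), ∀ t ∈ Icc (p l) (p (l + 1)),
      transportQuasimetric α (f s) (f t) = C l * |s - t| := by
    intro l hl s hs t ht
    have hs' := hmem l s hs
    have ht' := hmem l t ht
    rw [hf l hl s hs, hf l hl t ht, T.transportQuasimetric_transit hα hα1,
      hΓ l _ ⟨by linarith [hs'.1], by linarith [hs'.2]⟩ _ ⟨by linarith [ht'.1], by linarith [ht'.2]⟩,
      sub_sub_sub_cancel_right, ← mul_sub, abs_mul, abs_of_pos hKpos]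
    simp only [C]
    ring
  have hp0 : p 0 = 0 := by simp [p]
  have hpK : p K = 1 := div_self hKpos.ne'
  have hplt : ∀ l, p l < p (l + 1) := fun l => by
    simp only [p]; push_cast
    exact div_lt_div_of_pos_right (by linarith) hKpos
  have hcover : Icc (0 : ℝ) 1 ⊆ ⋃ l : Fin K, Icc (p l) (p (l + 1)) := by
    intro t ht
    rcases ht.2.lt_or_eq with hlt | rfl
    · have hnn : 0 ≤ K * t := mul_nonneg hKpos.le ht.1
      have hlt' : ⌊K * t⌋₊ < K := (Nat.floor_lt hnn).2 (mul_lt_of_lt_one_right hKpos hlt)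
      refine mem_iUnion.2 ⟨⟨⌊K * t⌋₊, hlt'⟩, ?_, ?_⟩
      · rw [div_le_iff₀' hKpos]; exact Nat.floor_le hnn
      · rw [le_div_iff₀' hKpos]; push_cast; exact (Nat.lt_floor_add_one _).le
    · refine mem_iUnion.2 ⟨⟨K - 1, by omega⟩, ?_⟩
      have : K - 1 + 1 = K := by omega
      simp only [this, hpK]
      refine ⟨?_, le_rfl⟩
      rw [← hpK]
      conv_rhs => rw [← this]
      exact (hplt _).le
  have hstart : f 0 = a := by
    apply Subtype.ext
    have := T.curve_natCast h0 0 (Nat.zero_le _)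
    simp only [f, mul_zero]
    rw [Nat.cast_zero] at this
    rw [this, T.state_zero]
  have hend : f 1 = b := by
    apply Subtype.ext
    simp only [f, mul_one]
    rw [T.curve_natCast h0 K le_rfl, T.state_last]
  refine ⟨f, ⟨⟨fun t ht => ?_, p, hp0, hpK, fun l hl => ⟨hplt l, ?_, C l, hCnn l hl,
    fun s hs t ht => (hJ l hl s hs t ht).le⟩⟩, hstart, hend⟩, ?_⟩
  -- Continuity is checked on each of the finitely many closed pieces; those that do not contain `t`
  -- contribute the trivial filter.
  · refine Tendsto.mono_left ?_ (nhdsWithin_mono t hcover)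
    rw [nhdsWithin_iUnion]
    refine tendsto_iSup.2 fun l => ?_
    obtain ⟨l, hl⟩ := l
    by_cases hmt : t ∈ Icc (p l) (p (l + 1))
    · have hlim : Tendsto (fun s => C l * |s - t|) (𝓝[Icc (p l) (p (l + 1))] t) (𝓝 0) := by
        have : Tendsto (fun s => C l * |s - t|) (𝓝 t) (𝓝 (C l * |t - t|)) :=
          Continuous.tendsto (by fun_prop) t
        rw [sub_self, abs_zero, mul_zero] at this
        exact this.mono_left nhdsWithin_le_nhds
      refine hlim.congr' ?_
      filter_upwards [self_mem_nhdsWithin] with s hs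
      exact (hJ l hl s hs t hmt).symm
    · rw [notMem_closure_iff_nhdsWithin_eq_bot.1 (by rwa [isClosed_Icc.closure_eq])]
      exact tendsto_bot
  · refine ⟨fun x _ y _ => hquasi.nonneg x y, fun x _ y _ => hquasi.eq_zero_iff x y,
      fun x _ y _ => hquasi.symm x y, ?_⟩
    rintro _ ⟨r, hr, rfl⟩ _ ⟨s, hs, rfl⟩ _ ⟨t, ht, rfl⟩
    rw [hJ l hl r hr s hs, hJ l hl r hr t ht, hJ l hl t ht s hs, ← mul_add]
    exact mul_le_mul_of_nonneg_left (abs_sub_le r t s) (hCnn l hl)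
  · have hpiece : ∀ l < K, ∫⁻ t in Icc (p l) (p (l + 1)),
        metricDeriv (transportQuasimetric α) f 0 1 t ≤
        ENNReal.ofReal (wt α (T.mass l) * dist (T.tail l) (T.head l)) := by
      intro l hl
      -- At the end points the upper limit may also see the adjacent piece, but these form a null
      -- set.
      have hder : ∀ t ∈ Ioo (p l) (p (l + 1)),
          metricDeriv (transportQuasimetric α) f 0 1 t ≤ ENNReal.ofReal (C l) := by
        intro t ht
        refine limsup_le_of_le (by isBoundedDefault) ?_
        filter_upwards [mem_nhdsWithin_of_mem_nhds (Icc_mem_nhds ht.1 ht.2),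
          self_mem_nhdsWithin] with s hs hst
        refine ENNReal.ofReal_le_ofReal ?_
        have : 0 < |s - t| := abs_pos.2 (sub_ne_zero.2 hst.2)
        rw [hJ l hl s hs t (Ioo_subset_Icc_self ht), mul_div_cancel_right₀ _ this.ne']
      calc ∫⁻ t in Icc (p l) (p (l + 1)), metricDeriv (transportQuasimetric α) f 0 1 t
          ≤ ∫⁻ _ in Icc (p l) (p (l + 1)), ENNReal.ofReal (C l) := by
            rw [← restrict_Ioo_eq_restrict_Icc]
            exact setLIntegral_mono' measurableSet_Ioo hder
        _ = ENNReal.ofReal (wt α (T.mass l) * dist (T.tail l) (T.head l)) := by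
            rw [setLIntegral_const, Real.volume_Icc, ← ENNReal.ofReal_mul (hCnn l hl)]
            congr 1
            simp only [C, p]
            push_cast
            field_simp
            ring
    calc curveLength (transportQuasimetric α) f 0 1
        ≤ ∫⁻ t in ⋃ l : Fin K, Icc (p l) (p (l + 1)),
            metricDeriv (transportQuasimetric α) f 0 1 t := lintegral_mono_set hcover
      _ ≤ ∑ l ∈ Finset.range K, ∫⁻ t in Icc (p l) (p (l + 1)),
            metricDeriv (transportQuasimetric α) f 0 1 t := by
          refine (lintegral_iUnion_le _ _).trans ?_
          rw [tsum_fintype, Fin.sum_univ_eq_sum_range fun l =>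
            ∫⁻ t in Icc (p l) (p (l + 1)), metricDeriv (transportQuasimetric α) f 0 1 t]
      _ ≤ ∑ l ∈ Finset.range K, ENNReal.ofReal (wt α (T.mass l) * dist (T.tail l) (T.head l)) :=
          Finset.sum_le_sum fun l hl => hpiece l (Finset.mem_range.1 hl)
      _ = ENNReal.ofReal (T.cost α) := by
          rw [Network.cost, ENNReal.ofReal_sum_of_nonneg]
          intro l hl
          exact mul_nonneg (wt_nonneg (T.isMoveBy l (Finset.mem_range.1 hl)).mass_nonneg)
            dist_nonneg

end Realization

end

end RamifiedTransport

namespace RamifiedTransport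

/-! ### Identification of the intrinsic distance. -/

section Perfect

variable {Y : Type*} [MetricSpace Y] {N : ℕ} {α : ℝ}

lemma distPieces_eq_chainDist (hY : IsGeodesicSpace Y) (hN : 1 ≤ N) (hα : 0 ≤ α) (hα1 : α < 1)
    (a b : AtomicProb N Y) {k : ℕ} (hk : 4 * N - 3 ≤ k) :
    distPieces (transportQuasimetric α) k a b = ENNReal.ofReal (chainDist α a b) := by
  apply le_antisymm
  · refine ENNReal.le_of_forall_pos_le_add fun ε hε _ => ?_
    obtain ⟨l, c, hc, hl⟩ := exists_chain_lt
      (lt_add_of_pos_right (chainDist α a b) (NNReal.coe_pos.2 hε))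
    obtain ⟨l', hl', c', hc', h⟩ := hl.exists_short hα hα1.le a.ne_zero a.2.2.2 b.2.2.2
    -- The shortened chain is padded to exactly `k` moves; `k` is positive because 4N-3 ≥ 1.
    obtain ⟨f, hf, hlen⟩ := (h.pad (hl'.trans hk)).exists_curve hY hα hα1.le (by omega)
    calc distPieces (transportQuasimetric α) k a b
        ≤ curveLength (transportQuasimetric α) f 0 1 := iInf₂_le f hf
      _ ≤ ENNReal.ofReal c' := hlen
      _ ≤ ENNReal.ofReal (chainDist α a b + ε) := ENNReal.ofReal_le_ofReal (hc'.trans hc.le)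
      _ = ENNReal.ofReal (chainDist α a b) + ε := by
          rw [ENNReal.ofReal_add (chainDist_nonneg _ _) ε.coe_nonneg, ENNReal.ofReal_coe_nnreal]
  · exact le_iInf₂ fun f hf => chainDist_le_curveLength hα hα1 hf

lemma intrinsicDist_eq_chainDist (hY : IsGeodesicSpace Y) (hN : 1 ≤ N) (hα : 0 ≤ α)
    (hα1 : α < 1) (a b : AtomicProb N Y) :
    intrinsicDist (transportQuasimetric α) a b = ENNReal.ofReal (chainDist α a b) := by
  refine Tendsto.limUnder_eq (tendsto_const_nhds.congr' ?_)
  filter_upwards [eventually_ge_atTop (4 * N - 3)] with k hk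
  exact (distPieces_eq_chainDist hY hN hα hα1 a b hk).symm

end Perfect

end RamifiedTransport

theorem mainTheorem2 {Y : Type*} [MetricSpace Y] [Nonempty Y]
    (hY : RamifiedTransport.IsGeodesicSpace Y) (N : ℕ) (hN : 1 ≤ N)
    (α : ℝ) (hα0 : 0 ≤ α) (hα1 : α < 1) :
    let J : RamifiedTransport.AtomicProb N Y → RamifiedTransport.AtomicProb N Y → ℝ :=
      RamifiedTransport.transportQuasimetric α
    RamifiedTransport.IsPerfectQuasimetric J ∧
    (∀ a b : RamifiedTransport.AtomicProb N Y, ∀ k : ℕ, 4 * N - 3 ≤ k →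
      RamifiedTransport.distPieces J k a b = RamifiedTransport.distPieces J (4 * N - 3) a b ∧
      RamifiedTransport.distPieces J k a b = RamifiedTransport.intrinsicDist J a b) ∧
    RamifiedTransport.IsMetricOn
      (fun a b : RamifiedTransport.AtomicProb N Y =>
        (RamifiedTransport.intrinsicDist J a b).toReal) Set.univ := by
  intro J
  have hdist : ∀ a b : RamifiedTransport.AtomicProb N Y, ∀ k : ℕ, 4 * N - 3 ≤ k →
      RamifiedTransport.distPieces J k a b =
        ENNReal.ofReal (RamifiedTransport.chainDist α a b) := fun a b k hk =>
    RamifiedTransport.distPieces_eq_chainDist hY hN hα0 hα1 a b hk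
  have hintr : ∀ a b : RamifiedTransport.AtomicProb N Y, RamifiedTransport.intrinsicDist J a b =
      ENNReal.ofReal (RamifiedTransport.chainDist α a b) :=
    RamifiedTransport.intrinsicDist_eq_chainDist hY hN hα0 hα1
  have hreal : ∀ a b : RamifiedTransport.AtomicProb N Y,
      (RamifiedTransport.intrinsicDist J a b).toReal = RamifiedTransport.chainDist α a b :=
    fun a b => by
      rw [hintr, ENNReal.toReal_ofReal (RamifiedTransport.chainDist_nonneg a b)]
  refine ⟨⟨RamifiedTransport.isQuasimetric_transportQuasimetric hα0 hα1.le hN, fun a b => ⟨?_, ?_⟩⟩,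
    fun a b k hk => ⟨?_, ?_⟩, ?_⟩
  · rw [hintr]; exact ENNReal.ofReal_ne_top
  · filter_upwards [eventually_ge_atTop (4 * N - 3)] with k hk
    rw [hdist a b k hk, hintr]
  · rw [hdist a b k hk, hdist a b _ le_rfl]
  · rw [hdist a b k hk, hintr]
  · refine ⟨fun a _ b _ => ENNReal.toReal_nonneg, fun a _ b _ => ?_, fun a _ b _ => ?_,
      fun a _ b _ c _ => ?_⟩
    · simp only [hreal]
      exact ⟨RamifiedTransport.eq_of_chainDist_eq_zero hα1.le,
        fun h => h ▸ RamifiedTransport.chainDist_self a⟩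
    · simp only [hreal]; exact RamifiedTransport.chainDist_symm a b
    · simp only [hreal]; exact RamifiedTransport.chainDist_triangle a b c
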